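/- For $t\in[0,1]$ let $c_t:[0,1]\to\{0,1\}$ be the threshold query $c_t(y)=1\iff y\le t$, and for a dataset $x\in[0,1]^n$ write $c_t(x)=\frac1n\sum_{i=1}^n c_t(x_i)$. Consider a stateful randomized algorithm $M$ that is given $x\in[0,1]^n$ and interacts for $k$ rounds with a randomized adversary $A$: in round $j$ the adversary chooses a threshold query $c_{t_j}$, depending on the previous queries and answers and its own randomness, and $M$ returns an answer $a_j\in[0,1]$. Let $(A\leftrightarrows M)(x)=(t_1,a_1,\dots,t_k,a_k)$ denote the random transcript. $M$ is $(\varepsilon,\delta)$-differentially private for $k$ adaptively chosen queries if for every adversary $A$, all $x,x'\in[0,1]^n$ differing in at most one entry and every measurable set $S$ of transcripts, $\Pr[(A\leftrightarrows M)(x)\in S]\le e^{\varepsilon}\Pr[(A\leftrightarrows M)(x')\in S]+\delta$. $M$ is $(\alpha,\beta)$-accurate for $k$ adaptively chosen threshold queries if for every adversary $A$ and every $x\in[0,1]^n$, $\Pr[\max_{j\le k}|c_{t_j}(x)-a_j|\le\alpha]\ge 1-\beta$. There is an absolute constant $C>0$ such that for all $\alpha,\beta,\varepsilon,\delta\in(0,1)$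 and all integers $k\ge1$ and $n$ with $$n\;\ge\; C\cdot\frac{\log k+\log^{2.5}(1/\alpha)+\log\!\big(1/(\beta\varepsilon\delta)\big)}{\alpha\varepsilon},$$ there is an algorithm $M$ on datasets in $[0,1]^n$ that is $(\varepsilon,\delta)$-differentially private for $k$ adaptively chosen queries and $(\alpha,\beta)$-accurate for $k$ adaptively chosen threshold queries. -/

import Mathlib

open MeasureTheory ProbabilityTheory

/-- A statistical query `q : X → {0,1}` evaluated on a dataset `x ∈ Xⁿ`:
the average of the predicate over the rows. -/
noncomputable def statQueryValue {X : Type} {n : ℕ} (q : X → Bool) (x : Fin n → X) : ℝ :=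
  (∑ i, if q (x i) then (1 : ℝ) else 0) / n

/-- The threshold query `c_t` over a totally ordered domain: `c_t(y) = 1` iff `y ≤ t`.
The class of threshold queries is the family `(c_t)` indexed by `t ∈ X`; since `t` is determined
by `c_t`, a threshold query is presented to an algorithm as the point `t`. -/
def thresholdQuery {X : Type} [LinearOrder X] (t : X) : X → Bool :=
  fun y => decide (y ≤ t)

/-- Two datasets are adjacent if they differ on only a single element. -/
def Adjacent {X : Type} {n : ℕ} (x x' : Fin n → X) : Prop :=
  ∃ i, ∀ j, j ≠ i → x j = x' j

/-- `(ε, δ)`-differential privacy of a randomized algorithm on `Xⁿ` with outputs in `Y`. -/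
def IsDiffPrivate {X : Type} [MeasurableSpace X] {n : ℕ} {Y : Type} [MeasurableSpace Y]
    (ε δ : ℝ) (K : Kernel (Fin n → X) Y) : Prop :=
  ∀ x x' : Fin n → X, Adjacent x x' → ∀ S : Set Y, MeasurableSet S →
    (K x).real S ≤ Real.exp ε * (K x').real S + δ

/-- A stateful, randomized, interactive algorithm.  It receives a dataset in `D` and randomly
initializes its internal state; on each query in `Q` it randomly produces an answer in `R`
and a new internal state. -/
structure InteractiveAlg (D Q R : Type) [MeasurableSpace D] [MeasurableSpace Q]
    [MeasurableSpace R] where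
  State : Type
  [measState : MeasurableSpace State]
  init : Kernel D State
  [markovInit : IsMarkovKernel init]
  answer : Kernel (State × Q) (R × State)
  [markovAnswer : IsMarkovKernel answer]

attribute [instance] InteractiveAlg.measState InteractiveAlg.markovInit
  InteractiveAlg.markovAnswer

/-- A stateful, randomized, adaptive adversary.  From its private state it randomly chooses the
next query; it then sees the answer and randomly updates its state. -/
structure Adversary (Q R : Type) [MeasurableSpace Q] [MeasurableSpace R] where
  State : Type
  [measState : MeasurableSpace State]
  init : Measure State
  [probInit : IsProbabilityMeasure init]
  query : Kernel State Q
  [markovQuery : IsMarkovKernel query]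
  update : Kernel (State × Q × R) State
  [markovUpdate : IsMarkovKernel update]

attribute [instance] Adversary.measState Adversary.probInit Adversary.markovQuery
  Adversary.markovUpdate

section Interaction

variable {D Q R : Type} [MeasurableSpace D] [MeasurableSpace Q] [MeasurableSpace R]

/-- One round of the interaction, from the pair (algorithm state, adversary state): the adversary
chooses a query `q`, the algorithm returns an answer and its new state, the adversary updates its
state. The outcome is `(q, (answer, new algorithm state), new adversary state)`. -/
noncomputable def interactionRound (M : InteractiveAlg D Q R) (A : Adversary Q R) :
    Kernel (M.State × A.State) (Q × (R × M.State) × A.State) :=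
  A.query.comap (fun p : M.State × A.State => p.2) measurable_snd ⊗ₖ
    (M.answer.comap (fun p : (M.State × A.State) × Q => (p.1.1, p.2)) (by fun_prop) ⊗ₖ
      A.update.comap
        (fun p : ((M.State × A.State) × Q) × (R × M.State) => (p.1.1.2, p.1.2, p.2.1))
        (by fun_prop))

/-- The random sequence `(q₁, a₁), …, (q_k, a_k)` produced by `k` further rounds of the
interaction, started from a given pair (algorithm state, adversary state). -/
noncomputable def transcriptFrom (M : InteractiveAlg D Q R) (A : Adversary Q R) :
    (k : ℕ) → Kernel (M.State × A.State) (Fin k → Q × R)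
  | 0 => Kernel.const _ (Measure.dirac Fin.elim0)
  | k + 1 =>
    (interactionRound M A ⊗ₖ
      (transcriptFrom M A k).comap
        (fun p : (M.State × A.State) × (Q × (R × M.State) × A.State) =>
          (p.2.2.1.2, p.2.2.2)) (by fun_prop)).map
      (fun p => Fin.cons (p.1.1, p.1.2.1.1) p.2)

/-- The output of `k` rounds of interaction between `A` and `M` on a given dataset: the queries
chosen by the adversary and the answers given by the algorithm. -/
noncomputable def interaction (M : InteractiveAlg D Q R) (A : Adversary Q R) (k : ℕ) :
    Kernel D (Fin k → Q × R) :=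
  transcriptFrom M A k ∘ₖ (M.init ×ₖ Kernel.const D A.init)

theorem measurable_finCons_transcript {P W : Type} [MeasurableSpace P] [MeasurableSpace W]
    {k : ℕ} :
    Measurable (fun p : (Q × (R × P) × W) × (Fin k → Q × R) =>
      (Fin.cons (p.1.1, p.1.2.1.1) p.2 : Fin (k + 1) → Q × R)) := by
  refine measurable_pi_iff.mpr fun i => ?_
  refine Fin.cases ?_ (fun j => ?_) i
  · simp only [Fin.cons_zero]; fun_prop
  · simp only [Fin.cons_succ]; fun_prop

instance instMarkovInteractionRound (M : InteractiveAlg D Q R) (A : Adversary Q R) :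
    IsMarkovKernel (interactionRound M A) := by
  unfold interactionRound; infer_instance

instance instMarkovTranscriptFrom (M : InteractiveAlg D Q R) (A : Adversary Q R) (k : ℕ) :
    IsMarkovKernel (transcriptFrom M A k) := by
  induction k with
  | zero => unfold transcriptFrom; infer_instance
  | succ k ih =>
    unfold transcriptFrom
    exact Kernel.IsMarkovKernel.map _ measurable_finCons_transcript

instance instMarkovInteraction (M : InteractiveAlg D Q R) (A : Adversary Q R) (k : ℕ) :
    IsMarkovKernel (interaction M A k) := by
  unfold interaction; infer_instance

end Interaction

/-- `M` is `(ε, δ)`-differentially private for `k` adaptively chosen queries: for every adversary,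
the output of the interaction is an `(ε, δ)`-differentially private function of the dataset. -/
def InteractiveAlg.IsPrivate {X Q R : Type} [MeasurableSpace X] [MeasurableSpace Q]
    [MeasurableSpace R] {n : ℕ} (M : InteractiveAlg (Fin n → X) Q R) (k : ℕ) (ε δ : ℝ) : Prop :=
  ∀ A : Adversary Q R, IsDiffPrivate ε δ (interaction M A k)

/-- `M` is `(α, β)`-accurate for `k` adaptively chosen statistical queries from the family
`fam`: for every adversary and every dataset, with probability at least `1 - β` every answer is
within `α` of the value of its query. -/
def InteractiveAlg.IsAccurate {X Q : Type} [MeasurableSpace X] [MeasurableSpace Q] {n : ℕ}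
    (M : InteractiveAlg (Fin n → X) Q unitInterval) (fam : Q → X → Bool) (k : ℕ) (α β : ℝ) :
    Prop :=
  ∀ (A : Adversary Q unitInterval) (x : Fin n → X),
    1 - β ≤ (interaction M A k x).real
      {τ | ∀ j, |statQueryValue (fam (τ j).1) x - ((τ j).2 : ℝ)| ≤ α}

/-!
The mechanism works with the rank function `N q = #{i | x i ≤ q}`.  It has `T = 2 ^ m - 1` switches
with `2 ^ m` of order `1 / α`; switch `i` has a target rank, the multiple `(i + 1) * (2 * D)` of a
number `2 * D` of order `α n`, displaced by noise.  While a switch has not fired, it fires on a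
query `q` with a probability that is `1` when `N q` is close to the target and decays like
`exp (-lam * distance)` away from it, with `lam = ε / 10`, down to a constant floor (`hazardAt`).
An unfired switch reports on which side of its target `N q` lies; a switch that fired at `q₀`
reports `q₀ ≤ q` forever after and never looks at the data again.  The position of the first
report `false` (or `T` if there is none), times `2 * D / n`, is the answer.

Privacy.  Replacing a point is removing one and inserting another.  When a point of rank `s` is
removed or inserted, the noise on the two datasets is coupled: all targets to the right of `s` move
by one together with the ranks there, so that these switches do not notice the change, and the
ranks near the targets to the left do not change.  One switch at most has its target near `s`.  The
coupling shrinks its inner radius by one, which lets it fire less often at every query, by a factor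
of at most `exp (2 * lam)` (`dominates_of_rankShift`).  A switch that fires less often makes the
event of not firing more likely, so only the firing itself, once for the whole interaction, costs
privacy: the loss is independent of the number `k` of queries (`Dominates.transcriptFrom_le`).  The
displacements are the partial sums of noise attached to the nodes of a dyadic tree, so that
moving all targets beyond a given one changes at most `m` noise variables (`sum_dyadicShift`),
which may therefore be Laplace variables of rate `lam / m`; the inner radius has an increasing
exponential law on `{0, …, W}`.  The error `δ` only pays for an inner radius that is already `0`
and for a displacement that is too large (`noiseLaw_compl_le`).

The median of the largest displacement is of order `m ^ 2 / lam`.  A tail at the rate `lam / m` of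
the node variables would multiply `log (1 / (β δ))` by `m`.  Instead, the law of the noise is tilted
by `exp (-lam * maxNoise)`.  As `maxNoise` moves by at most one under the coupling, this costs
another factor `exp lam`, and it makes the tail beyond the median decay at the rate `lam`
(`tiltedNoise_maxNoise_gt`).  So `log (1 / (β δ))` is added to `m ^ 2`, which is of order at most
`log (1 / α) ^ (5 / 2)` when `α < 1 / 2`.

Accuracy.  A union bound over the `k` rounds and `T` switches shows that with high probability no
switch fires far from its target (`transcriptFrom_not_mem_le`).  Then every report is correct up to
an error of `D` in the rank, and the answer up to `3 * D ≤ α * n` (`abs_rankAt_sub_le`).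
-/

/-! ### Unfolding one round of an interaction -/

section Rounds

variable {D Q R : Type} [MeasurableSpace D] [MeasurableSpace Q] [MeasurableSpace R]

theorem measurable_transcriptFrom_cons (M : InteractiveAlg D Q R) (A : Adversary Q R) (k : ℕ)
    {S : Set (Fin (k + 1) → Q × R)} (hS : MeasurableSet S) (q : Q) :
    Measurable (fun z : (R × M.State) × A.State =>
      transcriptFrom M A k (z.1.2, z.2)
        {τ | (Fin.cons (q, z.1.1) τ : Fin (k + 1) → Q × R) ∈ S}) := by
  have h := Kernel.measurable_kernel_prodMk_left
    (κ := (transcriptFrom M A k).comap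
      (fun z : (R × M.State) × A.State => (z.1.2, z.2)) (by fun_prop))
    (t := (fun p : ((R × M.State) × A.State) × (Fin k → Q × R) =>
      (Fin.cons (q, p.1.1.1) p.2 : Fin (k + 1) → Q × R)) ⁻¹' S)
    ((measurable_finCons_transcript.comp
      (f := fun p : ((R × M.State) × A.State) × (Fin k → Q × R) => ((q, p.1.1, p.1.2), p.2))
      (by fun_prop)) hS)
  exact h

theorem measurable_lintegral_update (M : InteractiveAlg D Q R) (A : Adversary Q R) (k : ℕ)
    {S : Set (Fin (k + 1) → Q × R)} (hS : MeasurableSet S) (q : Q) (w : A.State) :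
    Measurable (fun z : R × M.State => ∫⁻ w',
      transcriptFrom M A k (z.2, w') {τ | (Fin.cons (q, z.1) τ : Fin (k + 1) → Q × R) ∈ S}
        ∂A.update (w, q, z.1)) := by
  have h := (measurable_transcriptFrom_cons M A k hS q).lintegral_kernel_prod_right'
    (κ := A.update.comap (fun z : R × M.State => (w, q, z.1)) (by fun_prop))
  exact h

theorem transcriptFrom_succ_apply (M : InteractiveAlg D Q R) (A : Adversary Q R) (k : ℕ)
    (p : M.State × A.State) {S : Set (Fin (k + 1) → Q × R)} (hS : MeasurableSet S) :
    transcriptFrom M A (k + 1) p S =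
      ∫⁻ q, ∫⁻ z, ∫⁻ w', transcriptFrom M A k (z.2, w')
          {τ | (Fin.cons (q, z.1) τ : Fin (k + 1) → Q × R) ∈ S}
        ∂A.update (p.2, q, z.1) ∂M.answer (p.1, q) ∂A.query p.2 := by
  have hS' := measurable_finCons_transcript (Q := Q) (R := R) (P := M.State) (W := A.State) hS
  rw [transcriptFrom, Kernel.map_apply' _ measurable_finCons_transcript _ hS,
    Kernel.compProd_apply hS']
  have hm := Kernel.measurable_kernel_prodMk_left'
    (η := (transcriptFrom M A k).comap
        (fun p : (M.State × A.State) × (Q × (R × M.State) × A.State) =>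
          (p.2.2.1.2, p.2.2.2)) (by fun_prop)) hS' p
  rw [interactionRound, Kernel.lintegral_compProd _ _ _ hm]
  refine lintegral_congr fun q => ?_
  rw [Kernel.lintegral_compProd _ _ _ (by exact hm.comp (measurable_prodMk_left (x := q)))]
  rfl

end Rounds

/-! ### Mechanisms built from switches that fire at random -/

/-- The hidden parameter of the mechanism is a point of `Θ` (later: the data together with the
noise drawn in advance).  There are `T` switches; as long as switch `i` has not fired, it fires on
the query `q` with probability `hazard i (θ, q)`, and reports `side i (θ, q)`.  Once it has fired
at a query `q₀`, it reports of every query `q` whether `q₀ ≤ q`, without looking at `θ` again. The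
answer to a query is obtained from the `T` reports by `decode`. -/
structure SwitchFamily (Θ : Type) [MeasurableSpace Θ] (T : ℕ) where
  hazard : Fin T → Θ × unitInterval → ℝ
  side : Fin T → Θ × unitInterval → Bool
  decode : (Fin T → Bool) → unitInterval
  hazard_nonneg : ∀ i p, 0 ≤ hazard i p
  hazard_le_one : ∀ i p, hazard i p ≤ 1
  measurable_hazard : ∀ i, Measurable (hazard i)
  measurable_side : ∀ i, Measurable (side i)

namespace SwitchFamily

variable {Θ : Type} [MeasurableSpace Θ] {T : ℕ} (F : SwitchFamily Θ T)

/-- The public part of the state: which switches have fired, and at which query (the second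
component is meaningless for a switch that has not fired). -/
abbrev Status (T : ℕ) : Type := (Fin T → Bool) × (Fin T → unitInterval)

/-- Probability that switch `i` fires (`b = true`) or does not (`b = false`) in this round. -/
noncomputable def fireProb (p : (Θ × Status T) × unitInterval) (i : Fin T) (b : Bool) : ℝ :=
  if p.1.2.1 i then (if b then 0 else 1)
  else if b then F.hazard i (p.1.1, p.2) else 1 - F.hazard i (p.1.1, p.2)

/-- Probability that exactly the switches in `H` fire in this round. -/
noncomputable def patternProb (p : (Θ × Status T) × unitInterval) (H : Fin T → Bool) : ℝ :=
  ∏ i, F.fireProb p i (H i)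

/-- The public state after the switches in `H` have fired at the query `q`. -/
def nextStatus (u : Status T) (q : unitInterval) (H : Fin T → Bool) : Status T :=
  (fun i => u.1 i || H i, fun i => if H i then q else u.2 i)

/-- The reports of all switches on the query `q`. -/
noncomputable def report (θ : Θ) (u : Status T) (q : unitInterval) (i : Fin T) : Bool :=
  if u.1 i then decide (u.2 i ≤ q) else F.side i (θ, q)

/-- Answer and new state when the switches in `H` fire. -/
noncomputable def outcome (p : (Θ × Status T) × unitInterval) (H : Fin T → Bool) :
    unitInterval × (Θ × Status T) :=
  (F.decode (F.report p.1.1 (nextStatus p.1.2 p.2 H) p.2), (p.1.1, nextStatus p.1.2 p.2 H))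

theorem fireProb_nonneg (p : (Θ × Status T) × unitInterval) (i : Fin T) (b : Bool) :
    0 ≤ F.fireProb p i b := by
  have h0 := F.hazard_nonneg i (p.1.1, p.2)
  have h1 := F.hazard_le_one i (p.1.1, p.2)
  unfold fireProb
  split_ifs <;> linarith

theorem fireProb_true_add_false (p : (Θ × Status T) × unitInterval) (i : Fin T) :
    F.fireProb p i true + F.fireProb p i false = 1 := by
  unfold fireProb
  by_cases h : p.1.2.1 i = true <;> simp [h]

theorem patternProb_nonneg (p : (Θ × Status T) × unitInterval) (H : Fin T → Bool) :
    0 ≤ F.patternProb p H :=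
  Finset.prod_nonneg fun i _ => F.fireProb_nonneg p i _

theorem sum_patternProb (p : (Θ × Status T) × unitInterval) : ∑ H, F.patternProb p H = 1 := by
  have h := Finset.prod_univ_sum (fun _ : Fin T => (Finset.univ : Finset Bool))
    (fun i b => F.fireProb p i b)
  rw [Fintype.piFinset_univ] at h
  simp only [patternProb]
  rw [← h]
  exact Finset.prod_eq_one fun i _ => by
    rw [Fintype.sum_bool]; exact F.fireProb_true_add_false p i

/-- The probability that switch `i` fires is the marginal of the pattern distribution. -/
theorem sum_patternProb_of_fires (p : (Θ × Status T) × unitInterval) (i : Fin T) :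
    (∑ H : Fin T → Bool, if H i then F.patternProb p H else 0) = F.fireProb p i true := by
  classical
  have h := Finset.prod_univ_sum (fun _ : Fin T => (Finset.univ : Finset Bool))
    (fun j b => if j = i then (if b then F.fireProb p j b else 0) else F.fireProb p j b)
  rw [Fintype.piFinset_univ] at h
  have hr : ∀ H : Fin T → Bool, (∏ j, if j = i then (if H j then F.fireProb p j (H j) else 0)
      else F.fireProb p j (H j)) = if H i then F.patternProb p H else 0 := by
    intro H
    by_cases hi : H i = true
    · rw [if_pos hi]
      refine Finset.prod_congr rfl fun j _ => ?_
      by_cases hj : j = i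
      · subst hj; simp [hi]
      · simp [hj]
    · rw [if_neg hi]
      exact Finset.prod_eq_zero (Finset.mem_univ i) (by simp [hi])
  simp only [hr] at h
  rw [← h, Finset.prod_eq_single i]
  · simp
  · intro j _ hj
    rw [Fintype.sum_bool]
    simpa [hj] using F.fireProb_true_add_false p j
  · simp

theorem measurable_patternProb (H : Fin T → Bool) :
    Measurable (fun p : (Θ × Status T) × unitInterval => F.patternProb p H) := by
  refine Finset.measurable_prod _ fun i _ => ?_
  have hm : Measurable fun p : (Θ × Status T) × unitInterval => F.hazard i (p.1.1, p.2) :=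
    (F.measurable_hazard i).comp (by fun_prop)
  have hs : MeasurableSet {p : (Θ × Status T) × unitInterval | p.1.2.1 i = true} :=
    measurableSet_eq_fun (by fun_prop) measurable_const
  refine Measurable.ite hs measurable_const ?_
  by_cases hb : H i = true
  · simpa [hb] using hm
  · simp only [hb, Bool.false_eq_true, if_false]
    fun_prop

theorem measurable_nextStatus (H : Fin T → Bool) :
    Measurable (fun p : (Θ × Status T) × unitInterval => nextStatus p.1.2 p.2 H) := by
  refine Measurable.prodMk (measurable_pi_iff.mpr fun i => ?_) (measurable_pi_iff.mpr fun i => ?_)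
  · exact (measurable_from_top (f := fun b => b || H i)).comp (by fun_prop)
  · by_cases hb : H i = true
    · simpa [hb] using measurable_snd
    · simp only [hb, Bool.false_eq_true, if_false]; fun_prop

theorem measurable_outcome (H : Fin T → Bool) :
    Measurable (fun p : (Θ × Status T) × unitInterval => F.outcome p H) := by
  have hn := measurable_nextStatus (Θ := Θ) H
  have hrep : Measurable fun p : (Θ × Status T) × unitInterval =>
      F.report p.1.1 (nextStatus p.1.2 p.2 H) p.2 := by
    refine measurable_pi_iff.mpr fun i => ?_
    have h1 : Measurable fun p : (Θ × Status T) × unitInterval =>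
      (nextStatus p.1.2 p.2 H).1 i := (measurable_pi_apply i).comp (measurable_fst.comp hn)
    have h2 : Measurable fun p : (Θ × Status T) × unitInterval =>
      (nextStatus p.1.2 p.2 H).2 i := (measurable_pi_apply i).comp (measurable_snd.comp hn)
    refine Measurable.ite (measurableSet_eq_fun h1 measurable_const) ?_ ?_
    · refine measurable_to_bool ?_
      have : (fun p : (Θ × Status T) × unitInterval =>
          decide ((nextStatus p.1.2 p.2 H).2 i ≤ p.2)) ⁻¹' {true} =
          {p | (nextStatus p.1.2 p.2 H).2 i ≤ p.2} := by ext; simp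
      rw [this]
      exact measurableSet_le h2 measurable_snd
    · exact (F.measurable_side i).comp (by fun_prop)
  exact ((measurable_of_countable F.decode).comp hrep).prodMk (by fun_prop)

/-- The answer kernel of the switch mechanism: the pattern of firing switches is drawn, the rest
is deterministic. -/
noncomputable def answerKernel :
    Kernel ((Θ × Status T) × unitInterval) (unitInterval × (Θ × Status T)) where
  toFun p := ∑ H, ENNReal.ofReal (F.patternProb p H) • Measure.dirac (F.outcome p H)
  measurable' := by
    refine Measure.measurable_of_measurable_coe _ fun s hs => ?_
    simp only [Measure.coe_finsetSum, Finset.sum_apply, Measure.smul_apply, smul_eq_mul]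
    refine Finset.measurable_sum _ fun H _ => ?_
    refine (F.measurable_patternProb H).ennreal_ofReal.mul ?_
    exact (Measure.measurable_coe hs).comp (Measure.measurable_dirac.comp (F.measurable_outcome H))

theorem lintegral_answerKernel (p : (Θ × Status T) × unitInterval)
    {f : unitInterval × (Θ × Status T) → ENNReal} (hf : Measurable f) :
    ∫⁻ z, f z ∂F.answerKernel p =
      ∑ H, ENNReal.ofReal (F.patternProb p H) * f (F.outcome p H) := by
  change ∫⁻ z, f z ∂(∑ H, ENNReal.ofReal (F.patternProb p H) • Measure.dirac (F.outcome p H)) = _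
  rw [lintegral_finsetSum_measure]
  simp [lintegral_smul_measure, lintegral_dirac' _ hf]

theorem sum_ofReal_patternProb (p : (Θ × Status T) × unitInterval) :
    ∑ H, ENNReal.ofReal (F.patternProb p H) = 1 := by
  rw [← ENNReal.ofReal_sum_of_nonneg fun H _ => F.patternProb_nonneg p H, F.sum_patternProb,
    ENNReal.ofReal_one]

instance : IsMarkovKernel F.answerKernel where
  isProbabilityMeasure p := ⟨by
    have h := F.lintegral_answerKernel p (f := fun _ => 1) measurable_const
    simpa [F.sum_ofReal_patternProb p] using h⟩

/-- The interactive algorithm given by a family of switches: `κ` draws the hidden parameter from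
the data, and no switch has fired at the start. -/
noncomputable def toAlg {D : Type} [MeasurableSpace D] (κ : Kernel D Θ) [IsMarkovKernel κ] :
    InteractiveAlg D unitInterval unitInterval where
  State := Θ × Status T
  init := κ.map fun θ => (θ, (fun _ => false, fun _ => 0))
  markovInit := Kernel.IsMarkovKernel.map _ (by fun_prop)
  answer := F.answerKernel

section Transcript

variable {D : Type} [MeasurableSpace D] (κ : Kernel D Θ) [IsMarkovKernel κ]
  (A : Adversary unitInterval unitInterval)

theorem transcriptFrom_toAlg_succ (k : ℕ) (s : Θ × Status T) (w : A.State)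
    {S : Set (Fin (k + 1) → unitInterval × unitInterval)} (hS : MeasurableSet S) :
    transcriptFrom (F.toAlg κ) A (k + 1) (s, w) S =
      ∫⁻ q, ∑ H, ENNReal.ofReal (F.patternProb (s, q) H) *
        ∫⁻ w', transcriptFrom (F.toAlg κ) A k ((F.outcome (s, q) H).2, w')
          {τ | (Fin.cons (q, (F.outcome (s, q) H).1) τ :
            Fin (k + 1) → unitInterval × unitInterval) ∈ S}
          ∂A.update (w, q, (F.outcome (s, q) H).1) ∂A.query w := by
  rw [transcriptFrom_succ_apply _ _ _ _ hS]
  refine lintegral_congr fun q => ?_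
  exact F.lintegral_answerKernel (s, q) (measurable_lintegral_update (F.toAlg κ) A k hS q w)

theorem measurableSet_finCons {k : ℕ} {S : Set (Fin (k + 1) → unitInterval × unitInterval)}
    (hS : MeasurableSet S) (z : unitInterval × unitInterval) :
    MeasurableSet {τ | (Fin.cons z τ : Fin (k + 1) → unitInterval × unitInterval) ∈ S} := by
  have : Measurable fun τ : Fin k → unitInterval × unitInterval =>
      (Fin.cons z τ : Fin (k + 1) → unitInterval × unitInterval) := by
    refine measurable_pi_iff.mpr fun i => ?_
    refine Fin.cases ?_ (fun j => ?_) i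
    · simp only [Fin.cons_zero]; fun_prop
    · simp only [Fin.cons_succ]; fun_prop
  exact this hS

/-- The privacy budget still to be spent: switch `i` costs a factor `exp (γ i)` when it fires. -/
noncomputable def remainingCost (γ : Fin T → ℝ) (u : Status T) : ℝ :=
  ∏ i, if u.1 i then 1 else Real.exp (γ i)

theorem remainingCost_nonneg (γ : Fin T → ℝ) (u : Status T) : 0 ≤ remainingCost γ u :=
  Finset.prod_nonneg fun i _ => by split_ifs <;> positivity

/-- `θ'` dominates `θ` at cost `γ`: under `θ'` every switch is less likely to fire, but by a factor
of at most `exp (γ i)`, and the two sides can differ only where under `θ` the switch is sure to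
fire.  Not firing thus costs no privacy at all, whatever the number of queries. -/
def Dominates (θ θ' : Θ) (γ : Fin T → ℝ) : Prop :=
  ∀ i q, F.hazard i (θ', q) ≤ F.hazard i (θ, q) ∧
    F.hazard i (θ, q) ≤ Real.exp (γ i) * F.hazard i (θ', q) ∧
    (F.hazard i (θ, q) = 1 ∨ F.side i (θ, q) = F.side i (θ', q))

variable {F}

theorem Dominates.patternProb_mul_le {θ θ' : Θ} {γ : Fin T → ℝ} (h : F.Dominates θ θ' γ)
    (u : Status T) (q : unitInterval) (H : Fin T → Bool) :
    F.patternProb ((θ, u), q) H * remainingCost γ (nextStatus u q H) ≤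
      remainingCost γ u * F.patternProb ((θ', u), q) H := by
  unfold patternProb remainingCost
  rw [← Finset.prod_mul_distrib, ← Finset.prod_mul_distrib]
  refine Finset.prod_le_prod (fun i _ => mul_nonneg (F.fireProb_nonneg _ _ _)
    (by split_ifs <;> positivity)) fun i _ => ?_
  obtain ⟨h1, h2, -⟩ := h i q
  have hexp := Real.exp_pos (γ i)
  by_cases hu : u.1 i = true
  · simp [fireProb, nextStatus, hu]
  · by_cases hH : H i = true
    · simpa [fireProb, nextStatus, hu, hH] using h2
    · simp only [fireProb, nextStatus, hu, hH, Bool.or_self, Bool.false_eq_true, if_false]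
      rw [mul_comm]
      exact mul_le_mul_of_nonneg_left (by linarith) hexp.le

theorem Dominates.outcome_fst_eq {θ θ' : Θ} {γ : Fin T → ℝ} (h : F.Dominates θ θ' γ)
    (u : Status T) (q : unitInterval) (H : Fin T → Bool)
    (hH : F.patternProb ((θ, u), q) H ≠ 0) :
    (F.outcome ((θ, u), q) H).1 = (F.outcome ((θ', u), q) H).1 := by
  have hfire := Finset.prod_ne_zero_iff.mp hH
  simp only [outcome]
  congr 1
  funext i
  by_cases hn : (nextStatus u q H).1 i = true
  · simp [report, hn]
  · simp only [report, hn, Bool.false_eq_true, if_false]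
    obtain ⟨hu, hHi⟩ : u.1 i = false ∧ H i = false := by simpa [nextStatus] using hn
    refine (h i q).2.2.resolve_left fun h1 => hfire i (Finset.mem_univ i) ?_
    simp [fireProb, hu, hHi, h1]

/-- The factors of a step telescope through `remainingCost`: each switch is paid for once, when it
fires, so that the bound does not depend on the number `k` of rounds. -/
theorem Dominates.transcriptFrom_le {θ θ' : Θ} {γ : Fin T → ℝ} (h : F.Dominates θ θ' γ)
    (hγ : ∀ i, 0 ≤ γ i) (k : ℕ) : ∀ {S : Set (Fin k → unitInterval × unitInterval)},
    MeasurableSet S → ∀ (u : Status T) (w : A.State),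
    transcriptFrom (F.toAlg κ) A k ((θ, u), w) S ≤
      ENNReal.ofReal (remainingCost γ u) * transcriptFrom (F.toAlg κ) A k ((θ', u), w) S := by
  induction k with
  | zero =>
    intro S _ u w
    have h1 : 1 ≤ remainingCost γ u := by
      rw [← Finset.prod_const_one (s := (Finset.univ : Finset (Fin T)))]
      refine Finset.prod_le_prod (fun _ _ => zero_le_one) fun i _ => ?_
      split_ifs
      · exact le_rfl
      · exact Real.one_le_exp (hγ i)
    have h2 : (1 : ENNReal) ≤ ENNReal.ofReal (remainingCost γ u) := by simpa using h1
    exact le_mul_of_one_le_left' h2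
  | succ k ih =>
    intro S hS u w
    rw [F.transcriptFrom_toAlg_succ κ A k _ _ hS, F.transcriptFrom_toAlg_succ κ A k _ _ hS,
      ← lintegral_const_mul' _ _ ENNReal.ofReal_ne_top]
    refine lintegral_mono fun q => ?_
    simp only
    rw [Finset.mul_sum]
    refine Finset.sum_le_sum fun H _ => ?_
    by_cases hH : F.patternProb ((θ, u), q) H = 0
    · simp [hH]
    rw [h.outcome_fst_eq u q H hH]
    have hS' := measurableSet_finCons hS (q, (F.outcome ((θ', u), q) H).1)
    have hstep := lintegral_mono (μ := A.update (w, q, (F.outcome ((θ', u), q) H).1))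
      fun w' => ih hS' (nextStatus u q H) w'
    rw [lintegral_const_mul' _ _ ENNReal.ofReal_ne_top] at hstep
    refine (mul_le_mul_right hstep _).trans ?_
    rw [← mul_assoc, ← mul_assoc, ← ENNReal.ofReal_mul (F.patternProb_nonneg _ _),
      ← ENNReal.ofReal_mul (remainingCost_nonneg _ _)]
    exact mul_le_mul_left (ENNReal.ofReal_le_ofReal (h.patternProb_mul_le u q H)) _

variable (F)

/-- If a switch fires at a place that is not valid for it with probability at most `ρ` per query,
and if all answers given from valid firing places lie in `G`, then the transcript leaves `G` with
probability at most `k T ρ`. -/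
theorem transcriptFrom_not_mem_le (θ : Θ) (valid : Fin T → unitInterval → Prop) {ρ : ℝ}
    (hρ : 0 ≤ ρ) (hfar : ∀ i q, ¬ valid i q → F.hazard i (θ, q) ≤ ρ)
    {G : Set (unitInterval × unitInterval)} (hG : MeasurableSet G)
    (hacc : ∀ (q : unitInterval) (u : Status T), (∀ i, u.1 i = true → valid i (u.2 i)) →
      (q, F.decode (F.report θ u q)) ∈ G) (k : ℕ) :
    ∀ (u : Status T) (w : A.State), (∀ i, u.1 i = true → valid i (u.2 i)) →
      transcriptFrom (F.toAlg κ) A k ((θ, u), w) {τ | ¬ ∀ j, τ j ∈ G} ≤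
        ENNReal.ofReal (k * (T * ρ)) := by
  classical
  induction k with
  | zero => intro u w _; simp
  | succ k ih =>
    intro u w hu
    have hB : ∀ k : ℕ, MeasurableSet
        {τ : Fin k → unitInterval × unitInterval | ¬ ∀ j, τ j ∈ G} := by
      intro k
      have : {τ : Fin k → unitInterval × unitInterval | ∀ j, τ j ∈ G} =
        ⋂ j, (fun τ => τ j) ⁻¹' G := by ext; simp
      exact (this ▸ MeasurableSet.iInter fun j => measurable_pi_apply j hG).compl
    rw [F.transcriptFrom_toAlg_succ κ A k _ _ (hB _)]
    have key : ∀ q, ∑ H, ENNReal.ofReal (F.patternProb ((θ, u), q) H) *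
        ∫⁻ w', transcriptFrom (F.toAlg κ) A k ((F.outcome ((θ, u), q) H).2, w')
          {τ | (Fin.cons (q, (F.outcome ((θ, u), q) H).1) τ :
            Fin (k + 1) → unitInterval × unitInterval) ∈ {τ | ¬ ∀ j, τ j ∈ G}}
          ∂A.update (w, q, (F.outcome ((θ, u), q) H).1) ≤
        ENNReal.ofReal ((k + 1 : ℕ) * (T * ρ)) := by
      intro q
      set pp := fun H => F.patternProb ((θ, u), q) H with hpp
      have hpp0 : ∀ H, 0 ≤ pp H := fun H => F.patternProb_nonneg _ H
      set miss : (Fin T → Bool) → Fin T → ℝ :=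
        fun H i => if valid i q then 0 else if H i then pp H else 0 with hmiss
      have hmiss0 : ∀ H i, 0 ≤ miss H i := by
        intro H i
        simp only [hmiss]
        split_ifs
        · exact le_rfl
        · exact hpp0 H
        · exact le_rfl
      have hterm : ∀ H, ENNReal.ofReal (pp H) *
          ∫⁻ w', transcriptFrom (F.toAlg κ) A k ((F.outcome ((θ, u), q) H).2, w')
          {τ | (Fin.cons (q, (F.outcome ((θ, u), q) H).1) τ :
            Fin (k + 1) → unitInterval × unitInterval) ∈ {τ | ¬ ∀ j, τ j ∈ G}}
          ∂A.update (w, q, (F.outcome ((θ, u), q) H).1) ≤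
          ENNReal.ofReal (pp H * (k * (T * ρ)) + ∑ i, miss H i) := by
        intro H
        by_cases hex : ∃ i, ¬ valid i q ∧ H i = true
        · obtain ⟨i, hi, hHi⟩ := hex
          have hone : ∫⁻ w', transcriptFrom (F.toAlg κ) A k ((F.outcome ((θ, u), q) H).2, w')
              {τ | (Fin.cons (q, (F.outcome ((θ, u), q) H).1) τ :
                Fin (k + 1) → unitInterval × unitInterval) ∈ {τ | ¬ ∀ j, τ j ∈ G}}
              ∂A.update (w, q, (F.outcome ((θ, u), q) H).1) ≤ 1 := by
            refine (lintegral_mono (g := fun _ => 1) fun w' => prob_le_one).trans ?_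
            simp
          refine (mul_le_mul_right hone _).trans ?_
          rw [mul_one]
          refine ENNReal.ofReal_le_ofReal ?_
          have h1 : pp H = miss H i := by simp [hmiss, hi, hHi]
          have h2 := Finset.single_le_sum (f := miss H) (fun j _ => hmiss0 H j)
            (Finset.mem_univ i)
          have h3 : 0 ≤ pp H * (k * (T * ρ)) := by have := hpp0 H; positivity
          linarith
        · push Not at hex
          have hval : ∀ i, (nextStatus u q H).1 i = true → valid i ((nextStatus u q H).2 i) := by
            intro i hi
            by_cases hHi : H i = true
            · have := hex i
              simp only [nextStatus, hHi, if_true]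
              by_contra hc
              exact this hc hHi
            · have : u.1 i = true := by simpa [nextStatus, hHi] using hi
              simpa [nextStatus, hHi] using hu i this
          have hmem : (q, (F.outcome ((θ, u), q) H).1) ∈ G := hacc q _ hval
          have hset : {τ : Fin k → unitInterval × unitInterval |
              (Fin.cons (q, (F.outcome ((θ, u), q) H).1) τ :
                Fin (k + 1) → unitInterval × unitInterval) ∈ {τ | ¬ ∀ j, τ j ∈ G}} =
              {τ | ¬ ∀ j, τ j ∈ G} := by
            ext τ
            simp only [Set.mem_ofPred_eq, Fin.forall_fin_succ, Fin.cons_zero, Fin.cons_succ, hmem,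
              true_and]
          rw [hset]
          have hle : ∫⁻ w', transcriptFrom (F.toAlg κ) A k ((F.outcome ((θ, u), q) H).2, w')
              {τ | ¬ ∀ j, τ j ∈ G} ∂A.update (w, q, (F.outcome ((θ, u), q) H).1) ≤
              ENNReal.ofReal (k * (T * ρ)) := by
            refine (lintegral_mono (g := fun _ => ENNReal.ofReal (k * (T * ρ)))
              fun w' => ih (nextStatus u q H) w' hval).trans ?_
            simp
          refine (mul_le_mul_right hle _).trans ?_
          rw [← ENNReal.ofReal_mul (hpp0 H)]
          refine ENNReal.ofReal_le_ofReal ?_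
          have := Finset.sum_nonneg (s := Finset.univ) fun i _ => hmiss0 H i
          linarith
      refine (Finset.sum_le_sum fun H _ => hterm H).trans ?_
      rw [← ENNReal.ofReal_sum_of_nonneg fun H _ => add_nonneg
        (mul_nonneg (hpp0 H) (by positivity)) (Finset.sum_nonneg fun i _ => hmiss0 H i)]
      refine ENNReal.ofReal_le_ofReal ?_
      rw [Finset.sum_add_distrib, ← Finset.sum_mul, F.sum_patternProb, Finset.sum_comm]
      have hi : ∀ i ∈ (Finset.univ : Finset (Fin T)), ∑ H, miss H i ≤ ρ := by
        intro i _
        by_cases hv : valid i q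
        · simpa [hmiss, hv] using hρ
        · simp only [hmiss, hv, if_false]
          rw [hpp, F.sum_patternProb_of_fires]
          simp only [fireProb, if_true]
          split_ifs
          · exact hρ
          · exact hfar i q hv
      have hsum := Finset.sum_le_sum hi
      simp only [Finset.sum_const, Finset.card_univ, Fintype.card_fin, nsmul_eq_mul] at hsum
      push_cast
      linarith
    refine (lintegral_mono fun q => key q).trans ?_
    simp

/-- Probability that the transcript lies in `S`, for a fixed hidden parameter. -/
noncomputable def transcriptProb (k : ℕ) (S : Set (Fin k → unitInterval × unitInterval)) (θ : Θ) :
    ENNReal :=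
  ∫⁻ w, transcriptFrom (F.toAlg κ) A k ((θ, (fun _ => false, fun _ => 0)), w) S ∂A.init

theorem transcriptProb_le_one (k : ℕ) (S : Set (Fin k → unitInterval × unitInterval)) (θ : Θ) :
    F.transcriptProb κ A k S θ ≤ 1 := by
  refine (lintegral_mono (g := fun _ => 1) fun w' => prob_le_one).trans ?_
  simp

theorem measurable_transcriptProb (k : ℕ) {S : Set (Fin k → unitInterval × unitInterval)}
    (hS : MeasurableSet S) : Measurable (F.transcriptProb κ A k S) := by
  have hm := (Kernel.measurable_coe (transcriptFrom (F.toAlg κ) A k) hS).lintegral_prod_right'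
    (ν := A.init)
  have hs : Measurable fun θ : Θ => ((θ, (fun _ => false, fun _ => 0)) : Θ × Status T) := by
    fun_prop
  exact Measurable.comp (f := fun θ : Θ => ((θ, (fun _ => false, fun _ => 0)) : Θ × Status T))
    hm hs

theorem interaction_toAlg_apply (k : ℕ) (x : D) {S : Set (Fin k → unitInterval × unitInterval)}
    (hS : MeasurableSet S) :
    interaction (F.toAlg κ) A k x S = ∫⁻ θ, F.transcriptProb κ A k S θ ∂κ x := by
  have hm := Kernel.measurable_coe (transcriptFrom (F.toAlg κ) A k) hS
  rw [interaction, Kernel.comp_apply' _ _ _ hS, Kernel.prod_apply,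
    lintegral_prod _ hm.aemeasurable]
  exact Kernel.lintegral_map κ
    (f := fun θ : Θ => ((θ, (fun _ => false, fun _ => 0)) : Θ × Status T)) (by fun_prop) x
    hm.lintegral_prod_right'

variable {F}

theorem Dominates.transcriptProb_le {θ θ' : Θ} {γ : Fin T → ℝ} (h : F.Dominates θ θ' γ)
    (hγ : ∀ i, 0 ≤ γ i) (k : ℕ) {S : Set (Fin k → unitInterval × unitInterval)}
    (hS : MeasurableSet S) :
    F.transcriptProb κ A k S θ ≤
      ENNReal.ofReal (Real.exp (∑ i, γ i)) * F.transcriptProb κ A k S θ' := by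
  unfold transcriptProb
  rw [← lintegral_const_mul' _ _ ENNReal.ofReal_ne_top]
  refine lintegral_mono fun w => ?_
  have := h.transcriptFrom_le κ A hγ k hS (fun _ => false, fun _ => 0) w
  simpa [remainingCost, Real.exp_sum] using this

end Transcript

end SwitchFamily

/-! ### Change of noise in a countable probability space -/

/-- Privacy of a mechanism with countable noise from a map of the noise space: outside a set of
probability `δ`, the noise `ω` on one dataset is matched with the noise `φ ω` on the other. -/
theorem lintegral_le_of_injective {Ω : Type*} [MeasurableSpace Ω] [Countable Ω]
    [MeasurableSingletonClass Ω] (ν : Measure Ω) {φ : Ω → Ω} (hφ : Function.Injective φ)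
    {G : Set Ω} {c d δ : ENNReal} {f g : Ω → ENNReal}
    (hν : ∀ ω ∈ G, ν {ω} ≤ c * ν {φ ω}) (hfg : ∀ ω ∈ G, f ω ≤ d * g (φ ω))
    (hf : ∀ ω, f ω ≤ 1) (hG : ν Gᶜ ≤ δ) :
    ∫⁻ ω, f ω ∂ν ≤ c * d * ∫⁻ ω, g ω ∂ν + δ := by
  classical
  have hpt : ∀ ω, f ω * ν {ω} ≤
      c * d * (g (φ ω) * ν {φ ω}) + Gᶜ.indicator 1 ω * ν {ω} := by
    intro ω
    by_cases hω : ω ∈ G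
    · refine le_add_right ?_
      calc f ω * ν {ω} ≤ (d * g (φ ω)) * (c * ν {φ ω}) := mul_le_mul' (hfg ω hω) (hν ω hω)
        _ = _ := by ring
    · refine le_add_left ?_
      simpa [hω] using mul_le_mul_left (hf ω) (ν {ω})
  rw [lintegral_countable', lintegral_countable']
  refine (ENNReal.tsum_le_tsum hpt).trans ?_
  rw [ENNReal.tsum_add, ENNReal.tsum_mul_left]
  refine add_le_add (mul_le_mul_right
    (ENNReal.tsum_comp_le_tsum_of_injective hφ fun ω => g ω * ν {ω}) _) ?_
  rw [← lintegral_countable', lintegral_indicator_one (Set.to_countable _).measurableSet]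
  exact hG

/-! ### The discrete Laplace distribution -/

/-- Unnormalized discrete Laplace weight on `ℤ`. -/
noncomputable def laplaceWeight (a : ℝ) (z : ℤ) : ENNReal :=
  ENNReal.ofReal (Real.exp (-a)) ^ z.natAbs

theorem ofReal_exp_neg_lt_one {a : ℝ} (ha : 0 < a) : ENNReal.ofReal (Real.exp (-a)) < 1 := by
  rw [ENNReal.ofReal_lt_one, Real.exp_lt_one_iff]
  linarith

theorem tsum_laplaceWeight (a : ℝ) : ∑' z, laplaceWeight a z =
    ∑' n : ℕ, ENNReal.ofReal (Real.exp (-a)) ^ n +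
      ∑' n : ℕ, ENNReal.ofReal (Real.exp (-a)) ^ (n + 1) := by
  rw [tsum_of_nat_of_neg_add_one ENNReal.summable ENNReal.summable]
  congr 1

theorem tsum_laplaceWeight_ne_zero (a : ℝ) : ∑' z, laplaceWeight a z ≠ 0 := by
  intro h
  have := ENNReal.tsum_eq_zero.mp h 0
  simp [laplaceWeight] at this

theorem tsum_laplaceWeight_ne_top {a : ℝ} (ha : 0 < a) : ∑' z, laplaceWeight a z ≠ ⊤ := by
  have h1 : (1 - ENNReal.ofReal (Real.exp (-a)))⁻¹ ≠ ⊤ := by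
    rw [ENNReal.inv_ne_top]
    exact (tsub_pos_of_lt (ofReal_exp_neg_lt_one ha)).ne'
  rw [tsum_laplaceWeight, ENNReal.tsum_geometric_add_one, ENNReal.tsum_geometric]
  exact ENNReal.add_ne_top.mpr ⟨h1, ENNReal.mul_ne_top ENNReal.ofReal_ne_top h1⟩

/-- The discrete Laplace distribution, with probabilities proportional to `exp (-a |z|)`. -/
noncomputable def discreteLaplace (a : ℝ) (ha : 0 < a) : PMF ℤ :=
  PMF.normalize (laplaceWeight a) (tsum_laplaceWeight_ne_zero a) (tsum_laplaceWeight_ne_top ha)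

theorem laplaceWeight_le_mul (a : ℝ) (ha : 0 < a) (z d : ℤ) :
    laplaceWeight a z ≤ ENNReal.ofReal (Real.exp (a * d.natAbs)) * laplaceWeight a (z + d) := by
  unfold laplaceWeight
  rw [← ENNReal.ofReal_pow (Real.exp_pos _).le, ← ENNReal.ofReal_pow (Real.exp_pos _).le,
    ← ENNReal.ofReal_mul (Real.exp_pos _).le, ← Real.exp_nat_mul, ← Real.exp_nat_mul,
    ← Real.exp_add]
  refine ENNReal.ofReal_le_ofReal (Real.exp_le_exp.mpr ?_)
  have h : ((z + d).natAbs : ℝ) ≤ z.natAbs + d.natAbs := by exact_mod_cast Int.natAbs_add_le z d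
  nlinarith

theorem discreteLaplace_le_mul (a : ℝ) (ha : 0 < a) (z d : ℤ) :
    discreteLaplace a ha z ≤
      ENNReal.ofReal (Real.exp (a * d.natAbs)) * discreteLaplace a ha (z + d) := by
  unfold discreteLaplace
  rw [PMF.normalize_apply, PMF.normalize_apply, ← mul_assoc]
  exact mul_le_mul_left (laplaceWeight_le_mul a ha z d) _

/-- At half of the decay rate the exponential moment is bounded by an absolute constant. -/
theorem lintegral_exp_discreteLaplace (a : ℝ) (ha : 0 < a) :
    ∫⁻ z, ENNReal.ofReal (Real.exp (a / 2 * z.natAbs)) ∂(discreteLaplace a ha).toMeasure ≤ 4 := by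
  rw [lintegral_countable']
  have hterm : ∀ z : ℤ, ENNReal.ofReal (Real.exp (a / 2 * z.natAbs)) *
      (discreteLaplace a ha).toMeasure {z} =
      laplaceWeight (a / 2) z * (∑' z, laplaceWeight a z)⁻¹ := by
    intro z
    rw [PMF.toMeasure_apply_singleton _ _ (measurableSet_singleton z), discreteLaplace,
      PMF.normalize_apply, ← mul_assoc]
    congr 1
    unfold laplaceWeight
    rw [← ENNReal.ofReal_pow (Real.exp_pos _).le, ← ENNReal.ofReal_pow (Real.exp_pos _).le,
      ← ENNReal.ofReal_mul (Real.exp_pos _).le, ← Real.exp_nat_mul, ← Real.exp_nat_mul,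
      ← Real.exp_add]
    congr 2
    ring
  simp_rw [hterm]
  rw [ENNReal.tsum_mul_right, ← div_eq_mul_inv]
  refine ENNReal.div_le_of_le_mul ?_
  set x := ENNReal.ofReal (Real.exp (-(a / 2))) with hx
  have hx1 : x ≤ 1 := (ofReal_exp_neg_lt_one (by positivity)).le
  have hsq : ENNReal.ofReal (Real.exp (-a)) = x ^ 2 := by
    rw [hx, ← ENNReal.ofReal_pow (Real.exp_pos _).le, ← Real.exp_nat_mul]
    congr 2
    push_cast
    ring
  have h1 : ∑' n : ℕ, x ^ n ≤ 2 * ∑' n : ℕ, (x ^ 2) ^ n := by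
    rw [← tsum_even_add_odd (f := fun n => x ^ n) ENNReal.summable ENNReal.summable, two_mul]
    refine add_le_add (le_of_eq (tsum_congr fun n => (pow_mul x 2 n))) ?_
    refine ENNReal.tsum_le_tsum fun n => ?_
    rw [pow_succ, pow_mul]
    exact mul_le_of_le_one_right' hx1
  have h2 : ∑' n : ℕ, x ^ (n + 1) ≤ ∑' n : ℕ, x ^ n :=
    ENNReal.tsum_le_tsum fun n => by rw [pow_succ]; exact mul_le_of_le_one_right' hx1
  calc ∑' z, laplaceWeight (a / 2) z ≤ ∑' n : ℕ, x ^ n + ∑' n : ℕ, x ^ n := by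
        rw [tsum_laplaceWeight]; exact add_le_add_right h2 _
    _ ≤ 2 * ∑' n : ℕ, (x ^ 2) ^ n + 2 * ∑' n : ℕ, (x ^ 2) ^ n := add_le_add h1 h1
    _ = 4 * ∑' n : ℕ, (x ^ 2) ^ n := by ring
    _ ≤ 4 * ∑' z, laplaceWeight a z := by
        rw [tsum_laplaceWeight a, hsq]
        exact mul_le_mul_right le_self_add _

/-! ### Increasing exponential weights on an initial segment -/

/-- The distribution on `{0, …, W}` with probabilities proportional to `exp (lam j)`. -/
noncomputable def expIncreasing (lam : ℝ) (W : ℕ) : PMF (Fin (W + 1)) :=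
  PMF.normalize (fun j => ENNReal.ofReal (Real.exp (lam * j)))
    (by
      intro h
      have := ENNReal.tsum_eq_zero.mp h 0
      simp at this)
    (by simp [tsum_fintype])

theorem expIncreasing_zero_le (lam : ℝ) (W : ℕ) :
    expIncreasing lam W 0 ≤ ENNReal.ofReal (Real.exp (-(lam * W))) := by
  rw [expIncreasing, PMF.normalize_apply, Real.exp_neg,
    ENNReal.ofReal_inv_of_pos (Real.exp_pos _)]
  simp only [Fin.val_zero, Nat.cast_zero, mul_zero, Real.exp_zero, ENNReal.ofReal_one, one_mul]
  refine ENNReal.inv_le_inv.mpr ?_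
  have := ENNReal.le_tsum (f := fun j : Fin (W + 1) => ENNReal.ofReal (Real.exp (lam * j)))
    (Fin.last W)
  simpa using this

theorem expIncreasing_le_mul (lam : ℝ) (W : ℕ) {j : Fin (W + 1)} (hj : j ≠ 0) :
    expIncreasing lam W j ≤ ENNReal.ofReal (Real.exp lam) * expIncreasing lam W (j - 1) := by
  rw [expIncreasing, PMF.normalize_apply, PMF.normalize_apply, ← mul_assoc,
    ← ENNReal.ofReal_mul (Real.exp_pos _).le, ← Real.exp_add]
  refine le_of_eq ?_
  congr 3
  have h1 : ((j - 1 : Fin (W + 1)) : ℕ) + 1 = j := by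
    have := Fin.coe_sub_one j
    rw [if_neg hj] at this
    have h0 : (j : ℕ) ≠ 0 := fun h => hj (Fin.ext h)
    omega
  rw [← h1]
  push_cast
  ring

/-! ### Correlated noise with a tilted law -/

section Tilted

variable {V : Type} {T : ℕ} (S : Fin T → Finset V)

/-- Partial sum `t` of the noise variables. -/
def partialNoise (ξ : V → ℤ) (t : Fin T) : ℤ := ∑ v ∈ S t, ξ v

/-- The largest absolute value of a partial sum. -/
def maxNoise (ξ : V → ℤ) : ℕ := Finset.univ.sup fun t => (partialNoise S ξ t).natAbs

theorem natAbs_partialNoise_le (ξ : V → ℤ) (t : Fin T) :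
    (partialNoise S ξ t).natAbs ≤ maxNoise S ξ :=
  Finset.le_sup (f := fun t => (partialNoise S ξ t).natAbs) (Finset.mem_univ t)

theorem partialNoise_add (ξ s : V → ℤ) (t : Fin T) :
    partialNoise S (ξ + s) t = partialNoise S ξ t + partialNoise S s t := by
  simp [partialNoise, Finset.sum_add_distrib]

theorem maxNoise_add_le (ξ s : V → ℤ) (hs : ∀ t, (partialNoise S s t).natAbs ≤ 1) :
    maxNoise S (ξ + s) ≤ maxNoise S ξ + 1 := by
  refine Finset.sup_le fun t _ => ?_
  rw [partialNoise_add]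
  exact (Int.natAbs_add_le _ _).trans (add_le_add (natAbs_partialNoise_le S ξ t) (hs t))

variable [Fintype V]

/-- Independent discrete Laplace variables. -/
noncomputable def laplaceProduct (V : Type) [Fintype V] (a : ℝ) (ha : 0 < a) : Measure (V → ℤ) :=
  Measure.pi fun _ => (discreteLaplace a ha).toMeasure

instance (a : ℝ) (ha : 0 < a) : IsProbabilityMeasure (laplaceProduct V a ha) := by
  unfold laplaceProduct; infer_instance

/-- Chernoff bound for a sum of at most `m` independent discrete Laplace variables. -/
theorem laplaceProduct_partial_ge (a : ℝ) (ha : 0 < a) {m : ℕ} (U : Finset V) (hU : U.card ≤ m)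
    (B : ℝ) :
    laplaceProduct V a ha {ξ | B ≤ ((∑ v ∈ U, ξ v).natAbs : ℝ)} ≤
      ENNReal.ofReal (4 ^ m * Real.exp (-(a / 2 * B))) := by
  classical
  set f : V → (V → ℤ) → ENNReal := fun v ξ => ENNReal.ofReal (Real.exp (a / 2 * (ξ v).natAbs))
    with hf
  have hind : iIndepFun f (laplaceProduct V a ha) :=
    iIndepFun_pi (X := fun _ z => ENNReal.ofReal (Real.exp (a / 2 * (z : ℤ).natAbs)))
      fun i => (measurable_of_countable _).aemeasurable
  have hprod : ∫⁻ ξ, ∏ v ∈ U, f v ξ ∂laplaceProduct V a ha ≤ 4 ^ m := by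
    rw [lintegral_prod_eq_prod_lintegral_of_indepFun U f hind fun v => measurable_of_countable _]
    refine (Finset.prod_le_pow_card U _ 4 fun v _ => ?_).trans
      (pow_le_pow_right₀ (by norm_num) hU)
    have hmp := measurePreserving_eval (fun _ : V => (discreteLaplace a ha).toMeasure) v
    have := hmp.lintegral_comp (f := fun z : ℤ => ENNReal.ofReal (Real.exp (a / 2 * z.natAbs)))
      (measurable_of_countable _)
    exact this.trans_le (lintegral_exp_discreteLaplace a ha)
  have hmarkov := mul_meas_ge_le_lintegral (μ := laplaceProduct V a ha)
    (f := fun ξ => ∏ v ∈ U, f v ξ) (measurable_of_countable _)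
    (ENNReal.ofReal (Real.exp (a / 2 * B)))
  have hsub : {ξ : V → ℤ | B ≤ ((∑ v ∈ U, ξ v).natAbs : ℝ)} ⊆
      {ξ | ENNReal.ofReal (Real.exp (a / 2 * B)) ≤ ∏ v ∈ U, f v ξ} := by
    intro ξ hξ
    simp only [Set.mem_ofPred_eq] at hξ ⊢
    rw [hf, ← ENNReal.ofReal_prod_of_nonneg fun _ _ => (Real.exp_pos _).le, ← Real.exp_sum,
      ← Finset.mul_sum]
    refine ENNReal.ofReal_le_ofReal (Real.exp_le_exp.mpr ?_)
    refine mul_le_mul_of_nonneg_left (hξ.trans ?_) (by positivity)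
    exact_mod_cast Int.natAbs_sum_le U ξ
  have hc : ENNReal.ofReal (Real.exp (a / 2 * B)) ≠ 0 := by simp [Real.exp_pos]
  calc laplaceProduct V a ha {ξ | B ≤ ((∑ v ∈ U, ξ v).natAbs : ℝ)}
      ≤ laplaceProduct V a ha {ξ | ENNReal.ofReal (Real.exp (a / 2 * B)) ≤ ∏ v ∈ U, f v ξ} :=
        measure_mono hsub
    _ ≤ 4 ^ m / ENNReal.ofReal (Real.exp (a / 2 * B)) := by
        rw [ENNReal.le_div_iff_mul_le (Or.inl hc) (Or.inl ENNReal.ofReal_ne_top), mul_comm]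
        exact hmarkov.trans hprod
    _ = ENNReal.ofReal (4 ^ m * Real.exp (-(a / 2 * B))) := by
        rw [Real.exp_neg, ← div_eq_mul_inv, ENNReal.ofReal_div_of_pos (Real.exp_pos _),
          ENNReal.ofReal_pow (by norm_num)]
        norm_num

/-- The law of the noise: the product Laplace law, reweighted by `exp (-lam * maxNoise)`.  The
reweighting costs `lam` of privacy, since `maxNoise` moves by at most `1` under the shifts that
matter, and makes the tail of `maxNoise` decay at the full rate `lam` beyond its median. -/
noncomputable def tiltedNoise (a : ℝ) (ha : 0 < a) (lam : ℝ) : Measure (V → ℤ) :=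
  (laplaceProduct V a ha).tilted fun ξ => -(lam * maxNoise S ξ)

theorem integrable_exp_maxNoise (a : ℝ) (ha : 0 < a) {lam : ℝ} (hlam : 0 ≤ lam) :
    Integrable (fun ξ => Real.exp (-(lam * maxNoise S ξ))) (laplaceProduct V a ha) := by
  refine Integrable.of_bound (C := 1) (measurable_of_countable _).aestronglyMeasurable ?_
  refine Filter.Eventually.of_forall fun ξ => ?_
  rw [Real.norm_eq_abs, abs_of_pos (Real.exp_pos _), Real.exp_le_one_iff]
  have : 0 ≤ lam * maxNoise S ξ := by positivity
  linarith

theorem isProbabilityMeasure_tiltedNoise (a : ℝ) (ha : 0 < a) {lam : ℝ} (hlam : 0 ≤ lam) :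
    IsProbabilityMeasure (tiltedNoise S a ha lam) :=
  isProbabilityMeasure_tilted (integrable_exp_maxNoise S a ha hlam)

theorem tiltedNoise_singleton (a : ℝ) (ha : 0 < a) (lam : ℝ) (ξ : V → ℤ) :
    tiltedNoise S a ha lam {ξ} =
      ENNReal.ofReal (Real.exp (-(lam * maxNoise S ξ)) /
        ∫ ξ, Real.exp (-(lam * maxNoise S ξ)) ∂laplaceProduct V a ha) *
      ∏ v, discreteLaplace a ha (ξ v) := by
  rw [tiltedNoise, tilted_apply' _ _ (measurableSet_singleton ξ), lintegral_singleton,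
    laplaceProduct, Measure.pi_singleton]
  congr 1
  exact Finset.prod_congr rfl fun v _ =>
    PMF.toMeasure_apply_singleton _ _ (measurableSet_singleton _)

theorem tiltedNoise_singleton_le_mul (a : ℝ) (ha : 0 < a) {lam : ℝ} (hlam : 0 ≤ lam)
    (s : V → ℤ) (hs : ∀ t, (partialNoise S s t).natAbs ≤ 1) (ξ : V → ℤ) :
    tiltedNoise S a ha lam {ξ} ≤
      ENNReal.ofReal (Real.exp (lam + a * ∑ v, (s v).natAbs)) *
        tiltedNoise S a ha lam {ξ + s} := by
  rw [tiltedNoise_singleton, tiltedNoise_singleton]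
  set Z := ∫ ξ, Real.exp (-(lam * maxNoise S ξ)) ∂laplaceProduct V a ha with hZ
  have hZ0 : 0 ≤ Z := integral_nonneg fun ξ => (Real.exp_pos _).le
  have h1 : ENNReal.ofReal (Real.exp (-(lam * maxNoise S ξ)) / Z) ≤ ENNReal.ofReal (Real.exp lam) *
      ENNReal.ofReal (Real.exp (-(lam * maxNoise S (ξ + s))) / Z) := by
    rw [← ENNReal.ofReal_mul (Real.exp_pos _).le, ← mul_div_assoc, ← Real.exp_add]
    refine ENNReal.ofReal_le_ofReal (div_le_div_of_nonneg_right (Real.exp_le_exp.mpr ?_) hZ0)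
    have h : (maxNoise S (ξ + s) : ℝ) ≤ maxNoise S ξ + 1 := by
      exact_mod_cast maxNoise_add_le S ξ s hs
    nlinarith
  have h2 : ∏ v, discreteLaplace a ha (ξ v) ≤
      ENNReal.ofReal (Real.exp (a * ∑ v, (s v).natAbs)) *
        ∏ v, discreteLaplace a ha ((ξ + s) v) := by
    push_cast
    rw [Finset.mul_sum, Real.exp_sum, ENNReal.ofReal_prod_of_nonneg fun _ _ => (Real.exp_pos _).le,
      ← Finset.prod_mul_distrib]
    exact Finset.prod_le_prod' fun v _ => discreteLaplace_le_mul a ha (ξ v) (s v)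
  refine (mul_le_mul' h1 h2).trans (le_of_eq ?_)
  rw [Real.exp_add, ENNReal.ofReal_mul (Real.exp_pos _).le]
  ring

/-- The bound `T * 4 ^ m * exp (-a B / 2) ≤ 1 / 2` says that `B` is above the median of `maxNoise`
under the untilted law; past `B` the tail decays at rate `lam`, which may be much larger than the
rate `a` of the single Laplace variables. -/
theorem tiltedNoise_maxNoise_gt (a : ℝ) (ha : 0 < a) {lam : ℝ} (hlam : 0 ≤ lam) {m : ℕ}
    (hS : ∀ t, (S t).card ≤ m) {B : ℝ} (hB0 : 0 ≤ B)
    (hB : T * (4 ^ m * Real.exp (-(a / 2 * B))) ≤ 1 / 2) (E : ℝ) :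
    tiltedNoise S a ha lam {ξ | E < maxNoise S ξ} ≤
      ENNReal.ofReal (2 * Real.exp (-(lam * (E - B)))) := by
  set μ := laplaceProduct V a ha with hμ
  set Z := ∫ ξ, Real.exp (-(lam * maxNoise S ξ)) ∂μ with hZ
  have hlarge : μ {ξ | B < maxNoise S ξ} ≤ ENNReal.ofReal (1 / 2) := by
    have hsub : {ξ : V → ℤ | B < maxNoise S ξ} ⊆
        ⋃ t, {ξ | B ≤ ((∑ v ∈ S t, ξ v).natAbs : ℝ)} := by
      intro ξ hξ
      obtain ⟨t, -, ht⟩ := Finset.lt_sup_iff.mp ((Nat.floor_lt hB0).mpr hξ)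
      exact Set.mem_iUnion.mpr ⟨t, ((Nat.floor_lt hB0).mp ht).le⟩
    refine (measure_mono hsub).trans ((measure_iUnion_le _).trans ?_)
    rw [tsum_fintype]
    refine (Finset.sum_le_sum fun t _ => laplaceProduct_partial_ge a ha (S t) (hS t) B).trans ?_
    rw [Finset.sum_const, Finset.card_univ, Fintype.card_fin, nsmul_eq_mul,
      ← ENNReal.ofReal_natCast, ← ENNReal.ofReal_mul (Nat.cast_nonneg _)]
    exact ENNReal.ofReal_le_ofReal hB
  have hsmall : 1 / 2 ≤ μ.real {ξ | (maxNoise S ξ : ℝ) ≤ B} := by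
    have hc : {ξ : V → ℤ | (maxNoise S ξ : ℝ) ≤ B} = {ξ | B < maxNoise S ξ}ᶜ := by
      ext; simp
    have hr : μ.real {ξ | B < maxNoise S ξ} ≤ 1 / 2 :=
      ENNReal.toReal_le_of_le_ofReal (by norm_num) hlarge
    rw [hc, probReal_compl_eq_one_sub (Set.to_countable _).measurableSet]
    linarith
  have hZge : Real.exp (-(lam * B)) / 2 ≤ Z := by
    have hmono : ∫ ξ, {ξ | (maxNoise S ξ : ℝ) ≤ B}.indicator
        (fun _ => Real.exp (-(lam * B))) ξ ∂μ ≤ Z := by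
      refine integral_mono (Integrable.indicator (integrable_const _)
        (Set.to_countable _).measurableSet) (integrable_exp_maxNoise S a ha hlam) fun ξ => ?_
      by_cases hξ : (maxNoise S ξ : ℝ) ≤ B
      · simp only [Set.indicator, Set.mem_ofPred_eq, hξ, if_true]
        refine Real.exp_le_exp.mpr ?_
        nlinarith
      · simp only [Set.indicator, Set.mem_ofPred_eq, hξ, if_false]
        exact (Real.exp_pos _).le
    rw [integral_indicator_const _ (Set.to_countable _).measurableSet, smul_eq_mul] at hmono
    have := Real.exp_pos (-(lam * B))
    nlinarith
  have hZ0 : 0 < Z := lt_of_lt_of_le (by positivity) hZge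
  rw [tiltedNoise, tilted_apply' _ _ (Set.to_countable _).measurableSet]
  have hbound : ∀ ξ ∈ {ξ : V → ℤ | E < maxNoise S ξ},
      ENNReal.ofReal (Real.exp (-(lam * maxNoise S ξ)) / Z) ≤
        ENNReal.ofReal (2 * Real.exp (-(lam * (E - B)))) := by
    intro ξ hξ
    refine ENNReal.ofReal_le_ofReal ((div_le_iff₀ hZ0).mpr ?_)
    have h1 : Real.exp (-(lam * maxNoise S ξ)) ≤ Real.exp (-(lam * E)) := by
      have : E < maxNoise S ξ := hξ
      exact Real.exp_le_exp.mpr (by nlinarith)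
    have h2 : Real.exp (-(lam * (E - B))) * Real.exp (-(lam * B)) = Real.exp (-(lam * E)) := by
      rw [← Real.exp_add]; congr 1; ring
    have := Real.exp_pos (-(lam * (E - B)))
    nlinarith
  refine (setLIntegral_mono measurable_const hbound).trans ?_
  rw [setLIntegral_const]
  exact mul_le_of_le_one_right' prob_le_one

end Tilted

/-! ### Dyadic partial sums -/

/-- For `j < t`, the two binary expansions agree above exactly one position at which `t` has the
digit `1` and `j` the digit `0`; for `j ≥ t` there is no such position. -/
theorem sum_testBit_eq (m : ℕ) : ∀ j t : ℕ, j < 2 ^ m → t < 2 ^ m →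
    (∑ l ∈ Finset.range m, if t.testBit l = true ∧ j.testBit l = false ∧
      t / 2 ^ (l + 1) = j / 2 ^ (l + 1) then 1 else 0) = if j < t then 1 else 0 := by
  induction m with
  | zero => intro j t hj ht; simp at hj ht; simp [hj, ht]
  | succ m ih =>
    intro j t hj ht
    have h := ih (j / 2) (t / 2) (by rw [pow_succ] at hj; omega) (by rw [pow_succ] at ht; omega)
    rw [Finset.sum_range_succ']
    have hl : ∀ l : ℕ, (t.testBit (l + 1) = true ∧ j.testBit (l + 1) = false ∧
        t / 2 ^ (l + 1 + 1) = j / 2 ^ (l + 1 + 1)) ↔ ((t / 2).testBit l = true ∧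
        (j / 2).testBit l = false ∧ t / 2 / 2 ^ (l + 1) = j / 2 / 2 ^ (l + 1)) := by
      intro l
      rw [Nat.testBit_succ, Nat.testBit_succ, Nat.div_div_eq_div_mul, Nat.div_div_eq_div_mul,
        pow_succ' 2 (l + 1)]
    simp only [hl]
    rw [h]
    simp only [Nat.testBit_zero, zero_add, pow_one, decide_eq_true_eq, decide_eq_false_iff_not]
    split_ifs <;> omega

/-- The nodes of a dyadic tree: at level `l`, the interval of all numbers with quotient `u`
by `2 ^ (l + 1)`. -/
abbrev DyadicNode (m : ℕ) : Type := Fin m × Fin (2 ^ m)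

/-- The nodes whose lower halves make up `{0, …, t - 1}`. -/
def dyadicCover (m t : ℕ) : Finset (DyadicNode m) :=
  Finset.univ.filter fun v => t.testBit v.1 = true ∧ (v.2 : ℕ) = t / 2 ^ ((v.1 : ℕ) + 1)

/-- The nodes whose lower halves contain `j`. -/
def dyadicPath (m j : ℕ) : Finset (DyadicNode m) :=
  Finset.univ.filter fun v => j.testBit v.1 = false ∧ (v.2 : ℕ) = j / 2 ^ ((v.1 : ℕ) + 1)

theorem card_le_of_level {m : ℕ} (U : Finset (DyadicNode m)) (f : ℕ → ℕ)
    (h : ∀ v ∈ U, (v.2 : ℕ) = f v.1) : U.card ≤ m := by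
  have : U.card ≤ (Finset.univ : Finset (Fin m)).card := by
    refine Finset.card_le_card_of_injOn Prod.fst (fun _ _ => Finset.mem_univ _) ?_
    intro v hv w hw hvw
    refine Prod.ext hvw (Fin.ext ?_)
    rw [h v hv, h w hw, show v.1 = w.1 from hvw]
  simpa using this

theorem card_dyadicCover_le (m t : ℕ) : (dyadicCover m t).card ≤ m :=
  card_le_of_level _ (fun l => t / 2 ^ (l + 1)) fun _ hv => (Finset.mem_filter.mp hv).2.2

theorem card_dyadicPath_le (m j : ℕ) : (dyadicPath m j).card ≤ m :=
  card_le_of_level _ (fun l => j / 2 ^ (l + 1)) fun _ hv => (Finset.mem_filter.mp hv).2.2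

theorem card_cover_inter_path {m j t : ℕ} (hj : j < 2 ^ m) (ht : t < 2 ^ m) :
    (dyadicCover m t ∩ dyadicPath m j).card = if j < t then 1 else 0 := by
  rw [← sum_testBit_eq m j t hj ht, ← Fin.sum_univ_eq_sum_range (fun l =>
    if t.testBit l = true ∧ j.testBit l = false ∧ t / 2 ^ (l + 1) = j / 2 ^ (l + 1)
    then 1 else 0), dyadicCover, dyadicPath, ← Finset.filter_and, Finset.card_filter,
    Fintype.sum_prod_type]
  refine Finset.sum_congr rfl fun l _ => ?_
  have hlt : t / 2 ^ ((l : ℕ) + 1) < 2 ^ m := (Nat.div_le_self _ _).trans_lt ht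
  rw [Finset.sum_eq_single ⟨t / 2 ^ ((l : ℕ) + 1), hlt⟩]
  · simp only [and_true]
  · intro u _ hu
    refine if_neg fun h => hu (Fin.ext h.1.2)
  · simp

/-- The noise shift that moves all partial sums beyond `j` by `σ` and no others. -/
def dyadicShift (m j : ℕ) (σ : ℤ) (v : DyadicNode m) : ℤ := if v ∈ dyadicPath m j then σ else 0

theorem sum_dyadicShift {m j t : ℕ} (hj : j < 2 ^ m) (ht : t < 2 ^ m) (σ : ℤ) :
    ∑ v ∈ dyadicCover m t, dyadicShift m j σ v = if j < t then σ else 0 := by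
  unfold dyadicShift
  rw [← Finset.sum_filter, Finset.filter_mem_eq_inter, Finset.sum_const,
    card_cover_inter_path hj ht]
  split_ifs <;> simp

theorem sum_natAbs_dyadicShift_le (m j : ℕ) {σ : ℤ} (hσ : σ.natAbs ≤ 1) :
    ∑ v, (dyadicShift m j σ v).natAbs ≤ m := by
  unfold dyadicShift
  calc ∑ v, (if v ∈ dyadicPath m j then σ else 0).natAbs
      ≤ ∑ v, if v ∈ dyadicPath m j then 1 else 0 :=
        Finset.sum_le_sum fun _ _ => by split_ifs <;> simp [hσ]
    _ = (dyadicPath m j).card := by simp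
    _ ≤ m := card_dyadicPath_le m j

/-! ### The rank function of a dataset -/

/-- Number of data points at most `q`.  The entries are real numbers, so that a point can be taken
out of the dataset by moving it to `2`, beyond all queries. -/
noncomputable def rankAt {n : ℕ} (y : Fin n → ℝ) (q : unitInterval) : ℤ :=
  ∑ i, if y i ≤ (q : ℝ) then 1 else 0

theorem measurable_rankAt {n : ℕ} :
    Measurable fun p : (Fin n → ℝ) × unitInterval => rankAt p.1 p.2 := by
  refine Finset.measurable_sum _ fun i _ => ?_
  refine Measurable.ite (measurableSet_le (by fun_prop) ?_) measurable_const measurable_const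
  exact measurable_subtype_coe.comp measurable_snd

theorem rankAt_nonneg {n : ℕ} (y : Fin n → ℝ) (q : unitInterval) : 0 ≤ rankAt y q :=
  Finset.sum_nonneg fun i _ => by split_ifs <;> norm_num

theorem rankAt_le {n : ℕ} (y : Fin n → ℝ) (q : unitInterval) : rankAt y q ≤ n := by
  refine (Finset.sum_le_card_nsmul _ _ 1 fun i _ => by split_ifs <;> norm_num).trans ?_
  simp

theorem rankAt_mono {n : ℕ} (y : Fin n → ℝ) {q q' : unitInterval} (h : q ≤ q') :
    rankAt y q ≤ rankAt y q' := by
  refine Finset.sum_le_sum fun i _ => ?_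
  have : (q : ℝ) ≤ q' := h
  split_ifs <;> linarith

/-- `y'` arises from `y` by inserting (`σ = 1`) or removing (`σ = -1`) one point, of rank `s`. -/
def RankShift {n : ℕ} (y y' : Fin n → ℝ) (σ : ℤ) (s : ℕ) : Prop :=
  ∀ q, (rankAt y' q = rankAt y q + σ ∧ (s : ℤ) ≤ rankAt y q ∧ (s : ℤ) ≤ rankAt y' q) ∨
    (rankAt y' q = rankAt y q ∧ rankAt y q ≤ s)

theorem rankShift_update {n : ℕ} (y : Fin n → ℝ) (i : Fin n) :
    ∃ s, RankShift (Function.update y i 2) y 1 s ∧ RankShift y (Function.update y i 2) (-1) s := by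
  set z := Function.update y i 2 with hz
  have hr : ∀ q : unitInterval, rankAt y q = rankAt z q + if y i ≤ (q : ℝ) then 1 else 0 := by
    intro q
    have hq : ¬ (2 : ℝ) ≤ q := by have := q.2.2; linarith
    unfold rankAt
    rw [← Finset.add_sum_erase _ _ (Finset.mem_univ i),
      ← Finset.add_sum_erase Finset.univ
        (fun j => if z j ≤ (q : ℝ) then (1 : ℤ) else 0) (Finset.mem_univ i)]
    have : ∀ j ∈ Finset.univ.erase i, (if z j ≤ (q : ℝ) then (1 : ℤ) else 0) =
        if y j ≤ (q : ℝ) then 1 else 0 := by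
      intro j hj
      rw [hz, Function.update_of_ne (Finset.ne_of_mem_erase hj)]
    rw [Finset.sum_congr rfl this, hz, Function.update_self, if_neg hq]
    ring
  set s : ℕ := ∑ j, if z j < y i then 1 else 0 with hs
  have hlo : ∀ q : unitInterval, (q : ℝ) < y i → rankAt z q ≤ s := by
    intro q hq
    rw [hs]
    push_cast
    refine Finset.sum_le_sum fun j _ => ?_
    split_ifs <;> linarith
  have hhi : ∀ q : unitInterval, y i ≤ (q : ℝ) → (s : ℤ) ≤ rankAt z q := by
    intro q hq
    rw [hs]
    push_cast
    refine Finset.sum_le_sum fun j _ => ?_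
    split_ifs <;> linarith
  refine ⟨s, fun q => ?_, fun q => ?_⟩ <;> have h := hr q <;> by_cases hq : y i ≤ (q : ℝ)
  · rw [if_pos hq] at h
    have := hhi q hq
    left; omega
  · rw [if_neg hq] at h
    have := hlo q (not_le.mp hq)
    right; omega
  · rw [if_pos hq] at h
    have := hhi q hq
    left; omega
  · rw [if_neg hq] at h
    have := hlo q (not_le.mp hq)
    right; omega

/-! ### The threshold mechanism -/

/-- The hazard of a switch at distance `|d|` from its target, with inner radius `r + 1`: it fires
surely within the inner radius, and outside the hazard decays exponentially until it becomes
constant at distance `K`. -/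
noncomputable def hazardAt (lam : ℝ) (K : ℕ) (d : ℤ) (r : ℕ) : ℝ :=
  min 1 (Real.exp (-(lam * (((min d.natAbs K : ℕ) : ℝ) - (r + 1)))))

theorem hazardAt_eq_one {lam : ℝ} (hlam : 0 ≤ lam) {K : ℕ} {d : ℤ} {r : ℕ} (h : d.natAbs ≤ 1) :
    hazardAt lam K d r = 1 := by
  refine min_eq_left (Real.one_le_exp ?_)
  have h1 : min d.natAbs K ≤ 1 := (min_le_left _ _).trans h
  have h2 : ((min d.natAbs K : ℕ) : ℝ) ≤ 1 := by exact_mod_cast h1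
  have h3 : (0 : ℝ) ≤ r := by positivity
  nlinarith

theorem hazardAt_anti {lam : ℝ} (hlam : 0 ≤ lam) {K : ℕ} {d d' : ℤ} {r r' : ℕ}
    (h : min d.natAbs K + r' ≤ min d'.natAbs K + r) :
    hazardAt lam K d' r' ≤ hazardAt lam K d r := by
  refine min_le_min_left _ (Real.exp_le_exp.mpr ?_)
  have h' : ((min d.natAbs K : ℕ) : ℝ) + r' ≤ ((min d'.natAbs K : ℕ) : ℝ) + r := by
    exact_mod_cast h
  nlinarith

theorem hazardAt_le_mul {lam : ℝ} (hlam : 0 ≤ lam) {K : ℕ} {d d' : ℤ} {r r' : ℕ}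
    (h : min d'.natAbs K + r ≤ min d.natAbs K + r' + 2) :
    hazardAt lam K d r ≤ Real.exp (2 * lam) * hazardAt lam K d' r' := by
  have h' : ((min d'.natAbs K : ℕ) : ℝ) + r ≤ ((min d.natAbs K : ℕ) : ℝ) + r' + 2 := by
    exact_mod_cast h
  unfold hazardAt
  rw [mul_min_of_nonneg _ _ (Real.exp_pos _).le, ← Real.exp_add, mul_one]
  refine le_min ((min_le_left _ _).trans (Real.one_le_exp (by linarith)))
    ((min_le_right _ _).trans (Real.exp_le_exp.mpr ?_))
  nlinarith

theorem hazardAt_congr (lam : ℝ) {K : ℕ} {d d' : ℤ} (r : ℕ)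
    (h : min d.natAbs K = min d'.natAbs K) : hazardAt lam K d r = hazardAt lam K d' r := by
  unfold hazardAt; rw [h]

/-- The position of the first `false`, or `T` if there is none. -/
def firstFalse {T : ℕ} (b : Fin T → Bool) : ℕ :=
  Nat.find (p := fun j => ∀ h : j < T, b ⟨j, h⟩ = false) ⟨T, fun h => absurd h (lt_irrefl T)⟩

theorem firstFalse_spec {T : ℕ} (b : Fin T → Bool) (h : firstFalse b < T) :
    b ⟨firstFalse b, h⟩ = false :=
  Nat.find_spec (p := fun j => ∀ h : j < T, b ⟨j, h⟩ = false)
    ⟨T, fun h => absurd h (lt_irrefl T)⟩ h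

theorem firstFalse_le {T : ℕ} (b : Fin T → Bool) : firstFalse b ≤ T :=
  Nat.find_min' _ fun h => absurd h (lt_irrefl T)

theorem eq_true_of_lt_firstFalse {T : ℕ} (b : Fin T → Bool) (j : ℕ) (hj : j < firstFalse b)
    (hT : j < T) : b ⟨j, hT⟩ = true := by
  have := Nat.find_min (p := fun j => ∀ h : j < T, b ⟨j, h⟩ = false)
    ⟨T, fun h => absurd h (lt_irrefl T)⟩ hj
  push Not at this
  obtain ⟨_, h⟩ := this
  simpa using h

/-- The noise of the mechanism: the node variables, whose partial sums displace the targets, and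
the inner radii of the switches. -/
abbrev Noise (m T W : ℕ) : Type := (DyadicNode m → ℤ) × (Fin T → Fin (W + 1))

/-- The nodes whose variables displace target `i`. -/
def targetCover (m T : ℕ) (i : Fin T) : Finset (DyadicNode m) := dyadicCover m (i + 1)

/-- The target rank of switch `i`: a displaced multiple of `2 * D`. -/
def target {m T : ℕ} (D : ℕ) (ξ : DyadicNode m → ℤ) (i : Fin T) : ℤ :=
  ((i : ℕ) + 1 : ℕ) * (2 * D) + partialNoise (targetCover m T) ξ i

/-- Signed distance from the target of switch `i` to the rank of the query. -/
noncomputable def offset {n m T W : ℕ} (D : ℕ) (i : Fin T)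
    (p : ((Fin n → ℝ) × Noise m T W) × unitInterval) : ℤ :=
  rankAt p.1.1 p.2 - target D p.1.2.1 i

theorem measurable_offset {n m T W : ℕ} (D : ℕ) (i : Fin T) :
    Measurable (offset (n := n) (m := m) (T := T) (W := W) D i) := by
  have h1 : Measurable fun p : ((Fin n → ℝ) × Noise m T W) × unitInterval => rankAt p.1.1 p.2 :=
    measurable_rankAt.comp
      (f := fun p : ((Fin n → ℝ) × Noise m T W) × unitInterval => (p.1.1, p.2)) (by fun_prop)
  have h2 : Measurable fun p : ((Fin n → ℝ) × Noise m T W) × unitInterval => target D p.1.2.1 i :=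
    (measurable_of_countable fun ξ => target D ξ i).comp (by fun_prop)
  exact h1.sub h2

theorem measurable_hazardAt_offset {n m T W : ℕ} (D K : ℕ) (lam : ℝ) (i : Fin T) :
    Measurable fun p : ((Fin n → ℝ) × Noise m T W) × unitInterval =>
      hazardAt lam K (offset D i p) (p.1.2.2 i) := by
  have hr : Measurable fun p : ((Fin n → ℝ) × Noise m T W) × unitInterval => p.1.2.2 i :=
    (measurable_pi_apply i).comp (measurable_snd.comp (measurable_snd.comp measurable_fst))
  have h := (measurable_offset (n := n) (m := m) (T := T) (W := W) D i).prodMk hr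
  have hf : Measurable fun x : ℤ × Fin (W + 1) => hazardAt lam K x.1 x.2 :=
    measurable_of_countable _
  have hc := hf.comp h
  rw [Function.comp_def] at hc
  exact hc

/-- The switches have as targets the first `T` positive multiples of `2 * D`, displaced; switch `i`
reports whether the rank of the query has reached its target. -/
noncomputable def thresholdFamily (n m T W D K : ℕ) (lam : ℝ) :
    SwitchFamily ((Fin n → ℝ) × Noise m T W) T where
  hazard i p := hazardAt lam K (offset D i p) (p.1.2.2 i)
  side i p := decide (0 ≤ offset D i p)
  decode b := Set.projIcc 0 1 zero_le_one ((firstFalse b * (2 * D) : ℝ) / n)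
  hazard_nonneg _ _ := le_min zero_le_one (Real.exp_pos _).le
  hazard_le_one _ _ := min_le_left _ _
  measurable_hazard i := measurable_hazardAt_offset D K lam i
  measurable_side i := (measurable_of_countable fun d : ℤ => decide (0 ≤ d)).comp
    (measurable_offset D i)

theorem partialNoise_dyadicShift {m T c : ℕ} (hT : T < 2 ^ m) (σ : ℤ) (i : Fin T) :
    partialNoise (targetCover m T) (if c < 2 ^ m then dyadicShift m c σ else 0) i =
      if c < i + 1 then σ else 0 := by
  have hi : (i : ℕ) + 1 < 2 ^ m := by have := i.2; omega
  by_cases hc : c < 2 ^ m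
  · rw [if_pos hc]
    exact sum_dyadicShift hc hi σ
  · rw [if_neg hc, if_neg (by omega)]
    simp [partialNoise]

/-- The coupling behind privacy.  When a point of rank `s` is inserted or removed, the targets to
the right of `s` move along, and the switches whose targets are far from `s` behave exactly as
before.  Only target number `c`, counted from `1`, can be near `s`; its inner radius shrinks by
one, which makes up for the change of rank. -/
theorem dominates_of_rankShift {n m T W D K E : ℕ} {lam : ℝ} (hlam : 0 ≤ lam) (hT : T < 2 ^ m)
    (hK : 1 ≤ K) (hD : E + K + 1 ≤ D) {y y' : Fin n → ℝ} {σ : ℤ} (hσ : σ.natAbs ≤ 1) {s : ℕ}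
    (hy : RankShift y y' σ s) {c : ℕ} (hc : c = (s + D) / (2 * D)) {ω : Noise m T W}
    (hE : maxNoise (targetCover m T) ω.1 ≤ E) (hω : ∀ i : Fin T, (i : ℕ) + 1 = c → ω.2 i ≠ 0) :
    (thresholdFamily n m T W D K lam).Dominates (y, ω)
      (y', ω.1 + (if c < 2 ^ m then dyadicShift m c σ else 0),
        ω.2 - fun i : Fin T => if (i : ℕ) + 1 = c then 1 else 0)
      (fun i => if (i : ℕ) + 1 = c then 2 * lam else 0) := by
  intro i q
  have hη : (partialNoise (targetCover m T) ω.1 i).natAbs ≤ E :=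
    (natAbs_partialNoise_le _ _ i).trans hE
  set r' : Fin (W + 1) := ω.2 i - if (i : ℕ) + 1 = c then 1 else 0 with hr'
  set d := offset D i ((y, ω), q) with hd
  set d' := offset D i ((y', (ω.1 + (if c < 2 ^ m then dyadicShift m c σ else 0),
        ω.2 - fun i : Fin T => if (i : ℕ) + 1 = c then 1 else 0)), q) with hd'
  change hazardAt lam K d' r' ≤ hazardAt lam K d (ω.2 i) ∧
    hazardAt lam K d (ω.2 i) ≤ Real.exp (if (i : ℕ) + 1 = c then 2 * lam else 0) *
      hazardAt lam K d' r' ∧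
    (hazardAt lam K d (ω.2 i) = 1 ∨ decide (0 ≤ d) = decide (0 ≤ d'))
  simp only [offset, target, partialNoise_add, partialNoise_dyadicShift hT] at hd hd'
  simp only [decide_eq_decide]
  have hN := hy q
  set η := partialNoise (targetCover m T) ω.1 i
  set N := rankAt y q
  set N' := rankAt y' q
  have hDpos : 0 < 2 * D := by omega
  have hc1 : c * (2 * D) ≤ s + D := by rw [hc]; exact Nat.div_mul_le_self _ _
  have hc2 : s + D < (c + 1) * (2 * D) := by
    rw [hc]
    exact (Nat.lt_mul_of_div_lt (Nat.lt_succ_self _) hDpos).trans_eq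
      (by rw [Nat.succ_eq_add_one, mul_comm])
  rcases lt_trichotomy ((i : ℕ) + 1) c with hlt | heq | hgt
  -- For a target to the left of the point, both distances exceed `K` or neither changes.
  · have hmul : ((i : ℕ) + 1) * (2 * D) + 2 * D ≤ c * (2 * D) := by
      have := Nat.mul_le_mul_right (2 * D) (Nat.succ_le_of_lt hlt)
      rw [Nat.succ_mul] at this
      exact this
    have hb : ((((i : ℕ) + 1 : ℕ) : ℤ) * (2 * D)) + 2 * D ≤ s + D := by
      exact_mod_cast hmul.trans hc1
    rw [if_neg (by omega)] at hr' hd'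
    rw [if_neg (by omega), hr', sub_zero, Real.exp_zero, one_mul]
    generalize (((i : ℕ) + 1 : ℕ) : ℤ) * (2 * D) = b at *
    rw [hazardAt_congr lam _ (show min d.natAbs K = min d'.natAbs K by omega)]
    exact ⟨le_rfl, le_rfl, Or.inr (by omega)⟩
  · rw [if_pos heq] at hr'
    rw [if_neg (by omega)] at hd'
    rw [if_pos heq]
    have hr : (r' : ℕ) + 1 = ω.2 i := by
      have h := Fin.coe_sub_one (ω.2 i)
      rw [if_neg (hω i heq)] at h
      have h0 : ((ω.2 i : Fin (W + 1)) : ℕ) ≠ 0 := fun h => hω i heq (Fin.ext h)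
      rw [hr']
      omega
    generalize (((i : ℕ) + 1 : ℕ) : ℤ) * (2 * D) = b at *
    -- The distance changes by at most one, the radius shrinks by one: the hazard cannot increase,
    -- and it drops by at most two steps of the exponential.
    refine ⟨hazardAt_anti hlam (by omega), hazardAt_le_mul hlam (by omega), ?_⟩
    by_cases hs : (0 ≤ d ↔ 0 ≤ d')
    · exact Or.inr hs
    · exact Or.inl (hazardAt_eq_one hlam (by omega))
  -- A target to the right of the point moves along with the ranks beyond the point.
  · have hmul : (c + 1) * (2 * D) ≤ ((i : ℕ) + 1) * (2 * D) :=
      Nat.mul_le_mul_right _ hgt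
    have hb : ((s : ℤ) + D) < ((((i : ℕ) + 1 : ℕ) : ℤ) * (2 * D)) := by
      exact_mod_cast hc2.trans_le hmul
    rw [if_neg (by omega)] at hr'
    rw [if_pos hgt] at hd'
    rw [if_neg (by omega), hr', sub_zero, Real.exp_zero, one_mul]
    generalize (((i : ℕ) + 1 : ℕ) : ℤ) * (2 * D) = b at *
    rw [hazardAt_congr lam _ (show min d.natAbs K = min d'.natAbs K by omega)]
    exact ⟨le_rfl, le_rfl, Or.inr (by omega)⟩

/-- From the reports of the switches, the rank of the query is known up to `3 * D`. -/
theorem abs_rankAt_sub_le {n T D : ℕ} (hD : 0 < D) (hn : n ≤ (T + 1) * (2 * D)) (b : Fin T → Bool)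
    {N : ℤ} (hN0 : 0 ≤ N) (hNn : N ≤ n)
    (htrue : ∀ i, b i = true → (((i : ℕ) + 1 : ℕ) : ℤ) * (2 * D) - D ≤ N)
    (hfalse : ∀ i, b i = false → N ≤ (((i : ℕ) + 1 : ℕ) : ℤ) * (2 * D) + D) :
    |N - firstFalse b * (2 * D)| ≤ 3 * D := by
  have hlow : (firstFalse b : ℤ) * (2 * D) - D ≤ N := by
    rcases Nat.eq_zero_or_pos (firstFalse b) with h0 | hpos
    · rw [h0]; push_cast; omega
    · have hT := firstFalse_le b
      have h := htrue ⟨firstFalse b - 1, by omega⟩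
        (eq_true_of_lt_firstFalse b _ (by omega) (by omega))
      simpa [Nat.sub_add_cancel hpos] using h
  have hup : N ≤ (firstFalse b : ℤ) * (2 * D) + 3 * D := by
    rcases (firstFalse_le b).lt_or_eq with hlt | heq
    · have h := hfalse ⟨firstFalse b, hlt⟩ (firstFalse_spec b hlt)
      push_cast at h
      linarith
    · rw [heq]
      have : (n : ℤ) ≤ (T + 1) * (2 * D) := by exact_mod_cast hn
      linarith
  rw [abs_le]
  constructor <;> linarith

/-! ### Privacy and accuracy of the threshold mechanism -/

/-- The law of the noise: a tilted dyadic sum for the targets, and independent inner radii whose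
probabilities increase exponentially. -/
noncomputable def noiseLaw (m T W : ℕ) (a : ℝ) (ha : 0 < a) (lam : ℝ) : Measure (Noise m T W) :=
  (tiltedNoise (targetCover m T) a ha lam).prod
    (Measure.pi fun _ => (expIncreasing lam W).toMeasure)

theorem isProbabilityMeasure_noiseLaw (m T W : ℕ) (a : ℝ) (ha : 0 < a) {lam : ℝ}
    (hlam : 0 ≤ lam) : IsProbabilityMeasure (noiseLaw m T W a ha lam) := by
  have := isProbabilityMeasure_tiltedNoise (targetCover m T) a ha hlam
  unfold noiseLaw
  infer_instance

theorem sum_ite_succ_eq_le {T : ℕ} (c : ℕ) {x : ℝ} (hx : 0 ≤ x) :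
    ∑ i : Fin T, (if (i : ℕ) + 1 = c then x else 0) ≤ x := by
  rw [← Finset.sum_filter, Finset.sum_const, nsmul_eq_mul]
  have h : (Finset.univ.filter fun i : Fin T => (i : ℕ) + 1 = c).card ≤ 1 := by
    refine Finset.card_le_one.mpr fun i hi j hj => Fin.ext ?_
    have h1 := (Finset.mem_filter.mp hi).2
    have h2 := (Finset.mem_filter.mp hj).2
    omega
  have h' : ((Finset.univ.filter fun i : Fin T => (i : ℕ) + 1 = c).card : ℝ) ≤ 1 := by
    exact_mod_cast h
  nlinarith

theorem noiseLaw_singleton_le_mul {m T W : ℕ} (hT : T < 2 ^ m) {a : ℝ} (ha : 0 < a) {lam : ℝ}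
    (hlam : 0 ≤ lam) (ham : a * m ≤ lam) (c : ℕ) {σ : ℤ} (hσ : σ.natAbs ≤ 1) (ω : Noise m T W)
    (hω : ∀ i : Fin T, (i : ℕ) + 1 = c → ω.2 i ≠ 0) :
    noiseLaw m T W a ha lam {ω} ≤ ENNReal.ofReal (Real.exp (3 * lam)) *
      noiseLaw m T W a ha lam {(ω.1 + (if c < 2 ^ m then dyadicShift m c σ else 0),
        ω.2 - fun i : Fin T => if (i : ℕ) + 1 = c then 1 else 0)} := by
  have := isProbabilityMeasure_tiltedNoise (targetCover m T) a ha hlam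
  obtain ⟨ξ, r⟩ := ω
  rw [← Set.singleton_prod_singleton, ← Set.singleton_prod_singleton, noiseLaw,
    Measure.prod_prod, Measure.prod_prod, Measure.pi_singleton, Measure.pi_singleton]
  set sh : DyadicNode m → ℤ := if c < 2 ^ m then dyadicShift m c σ else 0 with hsh
  set sr : Fin T → Fin (W + 1) := fun i => if (i : ℕ) + 1 = c then 1 else 0 with hsr
  have h1 : tiltedNoise (targetCover m T) a ha lam {ξ} ≤
      ENNReal.ofReal (Real.exp (2 * lam)) *
        tiltedNoise (targetCover m T) a ha lam {ξ + sh} := by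
    refine (tiltedNoise_singleton_le_mul (targetCover m T) a ha hlam sh (fun t => ?_)
      ξ).trans (mul_le_mul_left (ENNReal.ofReal_le_ofReal (Real.exp_le_exp.mpr ?_)) _)
    · rw [hsh, partialNoise_dyadicShift hT]
      split_ifs
      · exact hσ
      · simp
    · have hs : ((∑ v, (sh v).natAbs : ℕ) : ℝ) ≤ m := by
        rw [hsh]
        split_ifs
        · exact_mod_cast sum_natAbs_dyadicShift_le m c hσ
        · simp
      nlinarith
  have h2 : ∏ i, (expIncreasing lam W).toMeasure {r i} ≤ ENNReal.ofReal (Real.exp lam) *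
      ∏ i, (expIncreasing lam W).toMeasure
        {(r - sr) i} := by
    have hi : ∀ i : Fin T, (expIncreasing lam W).toMeasure {r i} ≤
        ENNReal.ofReal (Real.exp (if (i : ℕ) + 1 = c then lam else 0)) *
        (expIncreasing lam W).toMeasure
          {(r - sr) i} := by
      intro i
      rw [PMF.toMeasure_apply_singleton _ _ (measurableSet_singleton _),
        PMF.toMeasure_apply_singleton _ _ (measurableSet_singleton _), Pi.sub_apply, hsr]
      by_cases h : (i : ℕ) + 1 = c
      · simp only [if_pos h]
        exact expIncreasing_le_mul lam W (hω i h)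
      · simp [if_neg h]
    refine (Finset.prod_le_prod' fun i _ => hi i).trans ?_
    rw [Finset.prod_mul_distrib, ← ENNReal.ofReal_prod_of_nonneg fun _ _ => (Real.exp_pos _).le,
      ← Real.exp_sum]
    exact mul_le_mul_left (ENNReal.ofReal_le_ofReal
      (Real.exp_le_exp.mpr (sum_ite_succ_eq_le c hlam))) _
  refine (mul_le_mul' h1 h2).trans (le_of_eq ?_)
  rw [show 3 * lam = 2 * lam + lam by ring, Real.exp_add, ENNReal.ofReal_mul (Real.exp_pos _).le]
  ring

/-- The noise vectors for which the coupling fails are rare. -/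
theorem noiseLaw_compl_le {m T W E : ℕ} {a : ℝ} (ha : 0 < a) {lam : ℝ}
    (hlam : 0 ≤ lam) (c : ℕ) {d : ℝ} (hd : 0 ≤ d)
    (hE : tiltedNoise (targetCover m T) a ha lam
      {ξ | (E : ℝ) < maxNoise (targetCover m T) ξ} ≤ ENNReal.ofReal d)
    (hW : Real.exp (-(lam * W)) ≤ d) :
    noiseLaw m T W a ha lam {ω | maxNoise (targetCover m T) ω.1 ≤ E ∧
      ∀ i : Fin T, (i : ℕ) + 1 = c → ω.2 i ≠ 0}ᶜ ≤ ENNReal.ofReal (2 * d) := by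
  have := isProbabilityMeasure_tiltedNoise (targetCover m T) a ha hlam
  have hsub : {ω : Noise m T W | maxNoise (targetCover m T) ω.1 ≤ E ∧
      ∀ i : Fin T, (i : ℕ) + 1 = c → ω.2 i ≠ 0}ᶜ ⊆
      {ξ | (E : ℝ) < maxNoise (targetCover m T) ξ} ×ˢ Set.univ ∪
      Set.univ ×ˢ {r | ∃ i : Fin T, (i : ℕ) + 1 = c ∧ r i = 0} := by
    rintro ⟨ξ, r⟩ hω
    by_cases h : maxNoise (targetCover m T) ξ ≤ E
    · right
      refine ⟨trivial, ?_⟩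
      by_contra hr
      exact hω ⟨h, fun i hi h0 => hr ⟨i, hi, h0⟩⟩
    · left
      refine ⟨?_, trivial⟩
      simpa using h
  refine (measure_mono hsub).trans ((measure_union_le _ _).trans ?_)
  rw [noiseLaw, Measure.prod_prod, Measure.prod_prod, measure_univ, measure_univ, mul_one, one_mul,
    two_mul, ENNReal.ofReal_add hd hd]
  refine add_le_add hE ?_
  by_cases hex : ∃ i : Fin T, (i : ℕ) + 1 = c
  · obtain ⟨i, hi⟩ := hex
    have hset : {r : Fin T → Fin (W + 1) | ∃ i : Fin T, (i : ℕ) + 1 = c ∧ r i = 0} ⊆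
        Function.eval i ⁻¹' {0} := by
      rintro r ⟨j, hj, h0⟩
      have : j = i := Fin.ext (by omega)
      subst this
      exact h0
    refine (measure_mono hset).trans ?_
    rw [(measurePreserving_eval (fun _ : Fin T => (expIncreasing lam W).toMeasure)
      i).measure_preimage (measurableSet_singleton _).nullMeasurableSet,
      PMF.toMeasure_apply_singleton _ _ (measurableSet_singleton _)]
    exact (expIncreasing_zero_le lam W).trans (ENNReal.ofReal_le_ofReal hW)
  · have : {r : Fin T → Fin (W + 1) | ∃ i : Fin T, (i : ℕ) + 1 = c ∧ r i = 0} = ∅ := by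
      refine Set.eq_empty_of_forall_notMem fun r hr => ?_
      obtain ⟨i, hi, -⟩ := hr
      exact hex ⟨i, hi⟩
    rw [this, measure_empty]
    exact zero_le

/-- Draws the noise and attaches it to the data. -/
noncomputable def noisyData (n m T W : ℕ) (a : ℝ) (ha : 0 < a) (lam : ℝ) :
    Kernel (Fin n → unitInterval) ((Fin n → ℝ) × Noise m T W) :=
  Kernel.deterministic (fun x i => (x i : ℝ)) (by fun_prop) ×ₖ
    Kernel.const _ (noiseLaw m T W a ha lam)

theorem isMarkovKernel_noisyData (n m T W : ℕ) (a : ℝ) (ha : 0 < a) {lam : ℝ} (hlam : 0 ≤ lam) :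
    IsMarkovKernel (noisyData n m T W a ha lam) := by
  have := isProbabilityMeasure_noiseLaw m T W a ha hlam
  unfold noisyData
  infer_instance

section Guarantees

variable {n m T W D K E : ℕ} {lam a : ℝ} (A : Adversary unitInterval unitInterval)
  (κ : Kernel (Fin n → unitInterval) ((Fin n → ℝ) × Noise m T W)) [IsMarkovKernel κ] (k : ℕ)

/-- Privacy for the insertion or removal of one point. -/
theorem lintegral_transcriptProb_le (hlam : 0 ≤ lam) (ha : 0 < a) (ham : a * m ≤ lam)
    (hT : T < 2 ^ m) (hK : 1 ≤ K) (hD : E + K + 1 ≤ D) {d : ℝ} (hd : 0 ≤ d)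
    (hE : tiltedNoise (targetCover m T) a ha lam
      {ξ | (E : ℝ) < maxNoise (targetCover m T) ξ} ≤ ENNReal.ofReal d)
    (hW : Real.exp (-(lam * W)) ≤ d) {y y' : Fin n → ℝ} {σ : ℤ} (hσ : σ.natAbs ≤ 1) {s : ℕ}
    (hy : RankShift y y' σ s) {S : Set (Fin k → unitInterval × unitInterval)}
    (hS : MeasurableSet S) :
    ∫⁻ ω, (thresholdFamily n m T W D K lam).transcriptProb κ A k S (y, ω)
        ∂noiseLaw m T W a ha lam ≤
      ENNReal.ofReal (Real.exp (5 * lam)) *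
        ∫⁻ ω, (thresholdFamily n m T W D K lam).transcriptProb κ A k S (y', ω)
          ∂noiseLaw m T W a ha lam + ENNReal.ofReal (2 * d) := by
  set c := (s + D) / (2 * D) with hc
  have hexp : Real.exp (5 * lam) = Real.exp (3 * lam) * Real.exp (2 * lam) := by
    rw [← Real.exp_add]; congr 1; ring
  rw [hexp, ENNReal.ofReal_mul (Real.exp_pos _).le]
  refine lintegral_le_of_injective (noiseLaw m T W a ha lam)
    (φ := fun ω => (ω.1 + (if c < 2 ^ m then dyadicShift m c σ else 0),
        ω.2 - fun i : Fin T => if (i : ℕ) + 1 = c then 1 else 0)) ?_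
    (G := {ω | maxNoise (targetCover m T) ω.1 ≤ E ∧
      ∀ i : Fin T, (i : ℕ) + 1 = c → ω.2 i ≠ 0})
    (fun ω hω => noiseLaw_singleton_le_mul hT ha hlam ham c hσ ω hω.2) (fun ω hω => ?_)
    (fun ω => SwitchFamily.transcriptProb_le_one _ _ _ _ _ _)
    (noiseLaw_compl_le ha hlam c hd hE hW)
  · intro ω ω' h
    simp only [Prod.mk.injEq, add_left_inj, sub_left_inj] at h
    exact Prod.ext h.1 h.2
  · have hdom := dominates_of_rankShift hlam hT hK hD hσ hy hc hω.1 hω.2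
    refine (hdom.transcriptProb_le κ A (fun i => ?_) k hS).trans ?_
    · split_ifs <;> linarith
    · exact mul_le_mul_left (ENNReal.ofReal_le_ofReal (Real.exp_le_exp.mpr
        (sum_ite_succ_eq_le c (by linarith)))) _

theorem statQueryValue_thresholdQuery {n : ℕ} (x : Fin n → unitInterval)
    (q : unitInterval) :
    statQueryValue (thresholdQuery q) x = (rankAt (fun i => (x i : ℝ)) q : ℝ) / n := by
  unfold statQueryValue thresholdQuery rankAt
  push_cast
  simp

/-- For fixed noise with small displacements, all answers are accurate unless some switch fires
far from its target. -/
theorem transcriptProb_inaccurate_le (hlam : 0 ≤ lam) (hn : 0 < n) (hWK : W + 1 ≤ K)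
    (hD : E + K + 1 ≤ D) (hnT : n ≤ (T + 1) * (2 * D)) {α : ℝ} (hα : 3 * D ≤ α * n)
    (x : Fin n → unitInterval) {ω : Noise m T W}
    (hω : maxNoise (targetCover m T) ω.1 ≤ E)
    (hG : MeasurableSet {z : unitInterval × unitInterval |
      |statQueryValue (thresholdQuery z.1) x - (z.2 : ℝ)| ≤ α}) :
    (thresholdFamily n m T W D K lam).transcriptProb κ A k
      {τ | ¬ ∀ j, τ j ∈ {z : unitInterval × unitInterval |
        |statQueryValue (thresholdQuery z.1) x - (z.2 : ℝ)| ≤ α}} (fun i => (x i : ℝ), ω) ≤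
      ENNReal.ofReal (k * (T * Real.exp (-(lam * (K - W - 1))))) := by
  set y : Fin n → ℝ := fun i => (x i : ℝ) with hy
  have hη : ∀ i : Fin T, (partialNoise (targetCover m T) ω.1 i).natAbs ≤ E := fun i =>
    (natAbs_partialNoise_le _ _ i).trans hω
  have key := fun w => (thresholdFamily n m T W D K lam).transcriptFrom_not_mem_le κ A (y, ω)
    (fun i q => (offset D i ((y, ω), q)).natAbs < K)
    (ρ := Real.exp (-(lam * (K - W - 1)))) (Real.exp_pos _).le ?_ hG ?_ k
    (fun _ => false, fun _ => 0) w (by simp)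
  · refine (lintegral_mono key).trans ?_
    simp
  · intro i q hq
    change hazardAt lam K (offset D i ((y, ω), q)) (ω.2 i) ≤ _
    refine (min_le_right _ _).trans (Real.exp_le_exp.mpr ?_)
    rw [min_eq_right (not_lt.mp hq)]
    have hr : ((ω.2 i : Fin (W + 1)) : ℝ) ≤ W := by
      exact_mod_cast Nat.lt_succ_iff.mp (ω.2 i).2
    nlinarith
  · intro q u hu
    set b := (thresholdFamily n m T W D K lam).report (y, ω) u q with hb
    have hDpos : 0 < D := by omega
    have hrank : |rankAt y q - firstFalse b * (2 * D)| ≤ 3 * D := by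
      refine abs_rankAt_sub_le hDpos hnT b (rankAt_nonneg y q) (rankAt_le y q) ?_ ?_
      · intro i hi
        have hηi := hη i
        by_cases hf : u.1 i = true
        · have hv := hu i hf
          have hle : u.2 i ≤ q := by simpa [hb, SwitchFamily.report, hf] using hi
          have hmono := rankAt_mono y hle
          simp only [offset, target] at hv
          generalize (((i : ℕ) + 1 : ℕ) : ℤ) * (2 * D) = B at *
          omega
        · have hside : 0 ≤ offset D i ((y, ω), q) := by
            simpa [hb, SwitchFamily.report, hf, thresholdFamily] using hi
          simp only [offset, target] at hside
          generalize (((i : ℕ) + 1 : ℕ) : ℤ) * (2 * D) = B at *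
          omega
      · intro i hi
        have hηi := hη i
        by_cases hf : u.1 i = true
        · have hv := hu i hf
          have hle : q < u.2 i := by simpa [hb, SwitchFamily.report, hf] using hi
          have hmono := rankAt_mono y hle.le
          simp only [offset, target] at hv
          generalize (((i : ℕ) + 1 : ℕ) : ℤ) * (2 * D) = B at *
          omega
        · have hside : offset D i ((y, ω), q) < 0 := by
            simpa [hb, SwitchFamily.report, hf, thresholdFamily] using hi
          simp only [offset, target] at hside
          generalize (((i : ℕ) + 1 : ℕ) : ℤ) * (2 * D) = B at *
          omega
    have hn' : (0 : ℝ) < n := by exact_mod_cast hn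
    have hmem : (rankAt y q : ℝ) / n ∈ Set.Icc (0 : ℝ) 1 := by
      have h0 : (0 : ℝ) ≤ rankAt y q := by exact_mod_cast rankAt_nonneg y q
      have h1 : (rankAt y q : ℝ) ≤ n := by exact_mod_cast rankAt_le y q
      exact ⟨by positivity, (div_le_one hn').mpr h1⟩
    change |statQueryValue (thresholdQuery q) x -
      (Set.projIcc (0 : ℝ) 1 zero_le_one ((firstFalse b * (2 * D) : ℝ) / n) : ℝ)| ≤ α
    rw [statQueryValue_thresholdQuery]
    have hproj := Set.abs_projIcc_sub_projIcc (zero_le_one (α := ℝ)) (c := (rankAt y q : ℝ) / n)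
      (d := (firstFalse b * (2 * D) : ℝ) / n)
    rw [Set.projIcc_of_mem _ hmem] at hproj
    refine hproj.trans ?_
    rw [← sub_div, abs_div, abs_of_pos hn', div_le_iff₀ hn']
    refine le_trans ?_ hα
    exact_mod_cast hrank

end Guarantees

theorem interaction_noisyData_apply {n m T W D K : ℕ} {lam a : ℝ} (hlam : 0 ≤ lam) (ha : 0 < a)
    [IsMarkovKernel (noisyData n m T W a ha lam)] (A : Adversary unitInterval unitInterval) (k : ℕ)
    (x : Fin n → unitInterval) {S : Set (Fin k → unitInterval × unitInterval)}
    (hS : MeasurableSet S) :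
    interaction ((thresholdFamily n m T W D K lam).toAlg (noisyData n m T W a ha lam)) A k x S =
      ∫⁻ ω, (thresholdFamily n m T W D K lam).transcriptProb (noisyData n m T W a ha lam) A k S
        (fun i => (x i : ℝ), ω) ∂noiseLaw m T W a ha lam := by
  have := isProbabilityMeasure_noiseLaw m T W a ha hlam
  have hm := (thresholdFamily n m T W D K lam).measurable_transcriptProb
    (noisyData n m T W a ha lam) A k hS
  rw [SwitchFamily.interaction_toAlg_apply _ _ _ _ _ hS]
  have hx : noisyData n m T W a ha lam x =
      (Measure.dirac fun i => (x i : ℝ)).prod (noiseLaw m T W a ha lam) := by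
    unfold noisyData
    rw [Kernel.prod_apply, Kernel.deterministic_apply, Kernel.const_apply]
  rw [hx, lintegral_prod _ hm.aemeasurable, lintegral_dirac' _ hm.lintegral_prod_right']

/-- Replacing a point amounts to removing it and inserting another. -/
theorem isPrivate_thresholdFamily {n m T W D K E k : ℕ} {lam a : ℝ} (hlam : 0 ≤ lam)
    (hlam1 : 5 * lam ≤ 1 / 2) (ha : 0 < a) [IsMarkovKernel (noisyData n m T W a ha lam)]
    (ham : a * m ≤ lam) (hT : T < 2 ^ m) (hK : 1 ≤ K) (hD : E + K + 1 ≤ D) {d : ℝ} (hd : 0 ≤ d)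
    (hE : tiltedNoise (targetCover m T) a ha lam
      {ξ | (E : ℝ) < maxNoise (targetCover m T) ξ} ≤ ENNReal.ofReal d)
    (hW : Real.exp (-(lam * W)) ≤ d) :
    ((thresholdFamily n m T W D K lam).toAlg (noisyData n m T W a ha lam)).IsPrivate k
      (10 * lam) (6 * d) := by
  intro A x x' hadj S hS
  obtain ⟨i, hi⟩ := hadj
  set y : Fin n → ℝ := fun j => (x j : ℝ) with hy
  set y' : Fin n → ℝ := fun j => (x' j : ℝ) with hy'
  obtain ⟨s, -, hs⟩ := rankShift_update y i
  obtain ⟨s', hs', -⟩ := rankShift_update y' i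
  have heq : Function.update y i 2 = Function.update y' i 2 := by
    funext j
    by_cases hj : j = i
    · subst hj; simp
    · simp [hj, hy, hy', hi j hj]
  rw [← heq] at hs'
  have h1 := lintegral_transcriptProb_le A (noisyData n m T W a ha lam) k hlam ha ham hT hK hD hd
    hE hW (by norm_num) hs hS
  have h2 := lintegral_transcriptProb_le A (noisyData n m T W a ha lam) k hlam ha ham hT hK hD hd
    hE hW (by norm_num) hs' hS
  rw [← interaction_noisyData_apply hlam ha A k x hS] at h1
  rw [← interaction_noisyData_apply hlam ha A k x' hS] at h2
  have h3 := h1.trans (add_le_add_left (mul_le_mul_right h2 _) _)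
  have hexp0 := Real.exp_pos (5 * lam)
  -- The two steps add up to the error `2 * d + exp (5 * lam) * (2 * d) ≤ 6 * d`.
  have hexp2 : Real.exp (5 * lam) ≤ 2 := by
    have h5 : Real.exp (5 * lam) ^ 2 ≤ 4 := by
      rw [← Real.exp_nat_mul]
      have : Real.exp ((2 : ℕ) * (5 * lam)) ≤ Real.exp 1 :=
        Real.exp_le_exp.mpr (by push_cast; linarith)
      have := Real.exp_one_lt_d9
      linarith
    nlinarith
  have hexp : Real.exp (10 * lam) = Real.exp (5 * lam) * Real.exp (5 * lam) := by
    rw [← Real.exp_add]; congr 1; ring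
  set P := interaction ((thresholdFamily n m T W D K lam).toAlg (noisyData n m T W a ha lam)) A k x
  set P' := interaction ((thresholdFamily n m T W D K lam).toAlg (noisyData n m T W a ha lam)) A k
    x'
  have hfin : P' S = ENNReal.ofReal (P'.real S) := (ofReal_measureReal).symm
  rw [hfin, ← ENNReal.ofReal_mul hexp0.le, ← ENNReal.ofReal_add (by positivity) (by positivity),
    ← ENNReal.ofReal_mul hexp0.le, ← ENNReal.ofReal_add (by positivity) (by positivity)] at h3
  refine (ENNReal.toReal_le_of_le_ofReal (by positivity) h3).trans ?_
  rw [hexp]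
  nlinarith

theorem measurableSet_accurate {n : ℕ} (x : Fin n → unitInterval) (α : ℝ) :
    MeasurableSet {z : unitInterval × unitInterval |
      |statQueryValue (thresholdQuery z.1) x - (z.2 : ℝ)| ≤ α} := by
  have hr : Measurable fun z : unitInterval × unitInterval =>
      rankAt (fun i => (x i : ℝ)) z.1 :=
    measurable_rankAt.comp (f := fun z : unitInterval × unitInterval =>
      ((fun i => (x i : ℝ)), z.1)) (by fun_prop)
  have hr' : Measurable fun z : unitInterval × unitInterval =>
      |(rankAt (fun i => (x i : ℝ)) z.1 : ℝ) / n - (z.2 : ℝ)| := by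
    have h1 : Measurable fun z : unitInterval × unitInterval =>
      (rankAt (fun i => (x i : ℝ)) z.1 : ℝ) := (measurable_of_countable _).comp hr
    have h2 : Measurable fun z : unitInterval × unitInterval => (z.2 : ℝ) :=
      measurable_subtype_coe.comp measurable_snd
    exact ((h1.div_const _).sub h2).abs
  simp only [statQueryValue_thresholdQuery]
  exact measurableSet_le hr' measurable_const

theorem measurableSet_forall_mem {k : ℕ} {G : Set (unitInterval × unitInterval)}
    (hG : MeasurableSet G) :
    MeasurableSet {τ : Fin k → unitInterval × unitInterval | ∀ j, τ j ∈ G} := by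
  have : {τ : Fin k → unitInterval × unitInterval | ∀ j, τ j ∈ G} =
    ⋂ j, (fun τ => τ j) ⁻¹' G := by ext; simp
  exact this ▸ MeasurableSet.iInter fun j => measurable_pi_apply j hG

theorem isAccurate_of_forall_le {n k : ℕ} {α β : ℝ} (hβ : 0 ≤ β)
    (M : InteractiveAlg (Fin n → unitInterval) unitInterval unitInterval)
    (h : ∀ (A : Adversary unitInterval unitInterval) (x : Fin n → unitInterval),
      interaction M A k x {τ | ¬ ∀ j, τ j ∈ {z : unitInterval × unitInterval |
        |statQueryValue (thresholdQuery z.1) x - (z.2 : ℝ)| ≤ α}} ≤ ENNReal.ofReal β) :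
    M.IsAccurate thresholdQuery k α β := by
  intro A x
  have hreal := ENNReal.toReal_le_of_le_ofReal hβ (h A x)
  have hcompl := probReal_compl_eq_one_sub (μ := interaction M A k x)
    (measurableSet_forall_mem (measurableSet_accurate x α))
  have hle : (interaction M A k x).real {τ | ∀ j, τ j ∈ {z : unitInterval × unitInterval |
      |statQueryValue (thresholdQuery z.1) x - (z.2 : ℝ)| ≤ α}}ᶜ ≤ β := hreal
  rw [hcompl] at hle
  change 1 - β ≤ (interaction M A k x).real {τ | ∀ j, τ j ∈ {z : unitInterval × unitInterval |
      |statQueryValue (thresholdQuery z.1) x - (z.2 : ℝ)| ≤ α}}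
  linarith

theorem isAccurate_thresholdFamily {n m T W D K E k : ℕ} {lam a : ℝ} (hlam : 0 ≤ lam)
    (ha : 0 < a) [IsMarkovKernel (noisyData n m T W a ha lam)] (hn : 0 < n) (hWK : W + 1 ≤ K)
    (hD : E + K + 1 ≤ D) (hnT : n ≤ (T + 1) * (2 * D)) {α β : ℝ} (hα : 3 * D ≤ α * n)
    (hβ : 0 ≤ β)
    (hE : tiltedNoise (targetCover m T) a ha lam
      {ξ | (E : ℝ) < maxNoise (targetCover m T) ξ} ≤ ENNReal.ofReal (β / 2))
    (hK : k * (T * Real.exp (-(lam * (K - W - 1)))) ≤ β / 2) :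
    ((thresholdFamily n m T W D K lam).toAlg (noisyData n m T W a ha lam)).IsAccurate
      thresholdQuery k α β := by
  refine isAccurate_of_forall_le hβ _ fun A x => ?_
  have := isProbabilityMeasure_noiseLaw m T W a ha hlam
  have := isProbabilityMeasure_tiltedNoise (targetCover m T) a ha hlam
  set G : Set (unitInterval × unitInterval) :=
    {z | |statQueryValue (thresholdQuery z.1) x - (z.2 : ℝ)| ≤ α}
  have hG : MeasurableSet G := measurableSet_accurate x α
  have hgood' : MeasurableSet {τ : Fin k → unitInterval × unitInterval | ¬ ∀ j, τ j ∈ G} :=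
    (measurableSet_forall_mem hG).compl
  rw [interaction_noisyData_apply hlam ha A k x hgood']
  set B : Set (Noise m T W) := {ξ | (E : ℝ) < maxNoise (targetCover m T) ξ} ×ˢ Set.univ with hB
  have hpt : ∀ ω, (thresholdFamily n m T W D K lam).transcriptProb (noisyData n m T W a ha lam) A k
      {τ | ¬ ∀ j, τ j ∈ G} (fun i => (x i : ℝ), ω) ≤ ENNReal.ofReal (β / 2) + B.indicator 1 ω := by
    intro ω
    by_cases hω : maxNoise (targetCover m T) ω.1 ≤ E
    · exact le_add_right ((transcriptProb_inaccurate_le A (noisyData n m T W a ha lam) k hlam hn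
        hWK hD hnT hα x hω hG).trans (ENNReal.ofReal_le_ofReal hK))
    · refine le_add_left ?_
      have : ω ∈ B := ⟨by simpa using hω, trivial⟩
      rw [Set.indicator_of_mem this]
      exact SwitchFamily.transcriptProb_le_one _ _ _ _ _ _
  refine (lintegral_mono hpt).trans ?_
  rw [lintegral_add_left measurable_const, lintegral_const, measure_univ, mul_one,
    lintegral_indicator_one (Set.to_countable _).measurableSet, noiseLaw, hB, Measure.prod_prod,
    measure_univ, mul_one]
  refine (add_le_add_right hE _).trans ?_
  rw [← ENNReal.ofReal_add (by positivity) (by positivity), add_halves]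

/-! ### The choice of the parameters -/

theorem sq_le_rpow_of_log_two_le {L : ℝ} (hL : 0.69 ≤ L) :
    L ^ 2 ≤ 1.25 * L ^ (5 / 2 : ℝ) ∧ 0.38 ≤ L ^ (5 / 2 : ℝ) := by
  have hL0 : 0 < L := by linarith
  have h1 : L ^ (5 / 2 : ℝ) = L ^ 2 * √L := by
    rw [show (5 / 2 : ℝ) = (2 : ℕ) + 1 / 2 by norm_num, Real.rpow_add hL0, Real.rpow_natCast,
      Real.sqrt_eq_rpow]
  have h2 : 0.8 ≤ √L := Real.le_sqrt_of_sq_le (by norm_num; linarith)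
  have h3 : 0.69 ^ 2 ≤ L ^ 2 := by gcongr
  rw [h1]
  constructor <;> nlinarith

/-- The number `m` of dyadic levels. -/
theorem exists_levels {α : ℝ} (hα : 0 < α) (hL : 0.69 ≤ Real.log (1 / α)) :
    ∃ m : ℕ, 1 ≤ m ∧ 4 / α ≤ 2 ^ m ∧ (m : ℝ) ^ 2 ≤ 45 * Real.log (1 / α) ^ (5 / 2 : ℝ) := by
  have hlog2 := Real.log_two_gt_d9
  have hlog2' := Real.log_two_lt_d9
  obtain ⟨hLsq, -⟩ := sq_le_rpow_of_log_two_le hL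
  have hlog4 : Real.log (4 / α) = 2 * Real.log 2 + Real.log (1 / α) := by
    rw [show 4 / α = 2 ^ 2 * (1 / α) by ring, Real.log_mul (by norm_num) (by positivity),
      Real.log_pow]
    norm_num
  set L := Real.log (1 / α)
  have hpos : 0 < Real.log (4 / α) / Real.log 2 := by rw [hlog4]; positivity
  have hlow := Nat.le_ceil (Real.log (4 / α) / Real.log 2)
  have hup := Nat.ceil_lt_add_one hpos.le
  set m := ⌈Real.log (4 / α) / Real.log 2⌉₊ with hm
  refine ⟨m, Nat.one_le_ceil_iff.mpr hpos, ?_, ?_⟩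
  · rw [div_le_iff₀ (by linarith)] at hlow
    have := Real.exp_le_exp.mpr hlow
    rwa [Real.exp_log (by positivity), Real.exp_nat_mul, Real.exp_log (by norm_num)] at this
  · have h2 : Real.log (4 / α) / Real.log 2 ≤ 2 + 1.45 * L := by
      rw [hlog4, div_le_iff₀ (by linarith)]
      nlinarith
    have h3 : (m : ℝ) ≤ 6 * L := by linarith
    have h4 : (m : ℝ) ^ 2 ≤ (6 * L) ^ 2 := by gcongr
    linarith [mul_pow 6 L 2]

theorem exists_nat_exp_neg_le {lam c : ℝ} (hlam : 0 < lam) (hlam1 : lam ≤ 1) (hc : 1 ≤ c) :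
    ∃ w : ℕ, Real.exp (-(lam * w)) ≤ 1 / c ∧ lam * w ≤ Real.log c + 1 := by
  have h0 : 0 ≤ Real.log c / lam := div_nonneg (Real.log_nonneg hc) hlam.le
  have hc0 : 0 < c := by linarith
  refine ⟨⌈Real.log c / lam⌉₊, ?_, ?_⟩
  · have h1 : Real.log c ≤ lam * ⌈Real.log c / lam⌉₊ := by
      have := Nat.le_ceil (Real.log c / lam)
      rw [div_le_iff₀ hlam] at this
      linarith
    calc Real.exp (-(lam * ⌈Real.log c / lam⌉₊)) ≤ Real.exp (-Real.log c) :=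
          Real.exp_le_exp.mpr (by linarith)
      _ = 1 / c := by rw [Real.exp_neg, Real.exp_log hc0, one_div]
  · have h1 := (Nat.ceil_lt_add_one h0).le
    calc lam * ⌈Real.log c / lam⌉₊ ≤ lam * (Real.log c / lam + 1) := by gcongr
      _ = Real.log c + lam := by field_simp
      _ ≤ Real.log c + 1 := by linarith

theorem log_const_mul_le {c x : ℝ} (hc : 0 < c) (hx : 0 < x) :
    Real.log (c * x) ≤ c + Real.log x := by
  rw [Real.log_mul hc.ne' hx.ne']
  linarith [Real.log_le_sub_one_of_pos hc]

/-- The hypothesis on `n`, cleared of denominators. -/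
theorem size_bound {k n : ℕ} {α β ε δ : ℝ} (hα : 0 < α)
    (hβ : 0 < β) (hε : 0 < ε) (hε1 : ε < 1) (hδ : 0 < δ)
    (hn : 100000 * ((Real.log k + Real.log (1 / α) ^ (5 / 2 : ℝ) +
      Real.log (1 / (β * ε * δ))) / (α * ε)) ≤ n) :
    100000 * (Real.log k + Real.log (1 / α) ^ (5 / 2 : ℝ) + Real.log (1 / β) +
      Real.log (1 / δ)) ≤ α * n * ε := by
  have hLe0 : 0 ≤ Real.log (1 / ε) := Real.log_nonneg (by rw [le_div_iff₀ hε]; linarith)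
  have hsplit : Real.log (1 / (β * ε * δ)) =
      Real.log (1 / β) + Real.log (1 / ε) + Real.log (1 / δ) := by
    rw [← Real.log_mul (by positivity) (by positivity),
      ← Real.log_mul (by positivity) (by positivity)]
    congr 1
    field_simp
  rw [hsplit, ← mul_div_assoc, div_le_iff₀ (by positivity)] at hn
  linarith [mul_assoc (n : ℝ) α ε, mul_comm (n : ℝ) α]

/-- The size of the dataset leaves room for the displacement `E` of the targets and for the outer
radius `K` of the switches; `8 * m ^ 2 / (ε / 10)` bounds the median of the displacement. -/
theorem exists_parameters {k n : ℕ} {α β ε δ : ℝ} (hk : 1 ≤ k) (hα : 0 < α) (hα2 : α < 1 / 2)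
    (hβ : 0 < β) (hβ1 : β < 1) (hε : 0 < ε) (hε1 : ε < 1) (hδ : 0 < δ) (hδ1 : δ < 1)
    (hn : 100000 * ((Real.log k + Real.log (1 / α) ^ (5 / 2 : ℝ) +
      Real.log (1 / (β * ε * δ))) / (α * ε)) ≤ n) :
    ∃ m W K E D : ℕ, 1 ≤ m ∧ W + 1 ≤ K ∧ E + K + 1 ≤ D ∧ n ≤ 2 ^ m * (2 * D) ∧ 3 * D ≤ α * n ∧
      Real.exp (-(ε / 10 * W)) ≤ δ / 6 ∧
      k * (2 ^ m * Real.exp (-(ε / 10 * (K - W - 1)))) ≤ β / 2 ∧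
      2 * Real.exp (-(ε / 10 * (E - 8 * m ^ 2 / (ε / 10)))) ≤ β * δ / 6 := by
  have hsize := size_bound hα hβ hε hε1 hδ hn
  clear hn
  obtain ⟨lam, hlamdef⟩ : ∃ lam, lam = ε / 10 := ⟨_, rfl⟩
  have hlam : 0 < lam := by rw [hlamdef]; positivity
  have hlam1 : lam ≤ 1 := by linarith
  rw [← hlamdef]
  have hLge : 0.69 ≤ Real.log (1 / α) := by
    have : Real.log 2 ≤ Real.log (1 / α) := by
      refine Real.log_le_log (by norm_num) ?_
      rw [le_div_iff₀ hα]; linarith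
    linarith [Real.log_two_gt_d9]
  have hX := (sq_le_rpow_of_log_two_le hLge).2
  obtain ⟨m, hm1, hmpow, hmsq⟩ := exists_levels hα hLge
  have hk' : (1 : ℝ) ≤ k := by exact_mod_cast hk
  have hβi : 1 ≤ 1 / β := by rw [le_div_iff₀ hβ]; linarith
  have hδi : 1 ≤ 1 / δ := by rw [le_div_iff₀ hδ]; linarith
  have hpow : (1 : ℝ) ≤ 2 ^ m := one_le_pow₀ (by norm_num)
  have hLk0 := Real.log_nonneg hk'
  have hLb0 := Real.log_nonneg hβi
  have hLd0 := Real.log_nonneg hδi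
  have hβδ : 1 ≤ 1 / β * (1 / δ) := one_le_mul_of_one_le_of_one_le hβi hδi
  have hkm : 1 ≤ k * 2 ^ m * (1 / β) :=
    one_le_mul_of_one_le_of_one_le (one_le_mul_of_one_le_of_one_le hk' hpow) hβi
  -- `W` is the largest inner radius, `g` the further distance that makes firing unlikely in all
  -- rounds, and `e` the distance beyond the median that makes large displacements unlikely.
  obtain ⟨W, hW, hWup⟩ := exists_nat_exp_neg_le (c := 6 * (1 / δ)) hlam hlam1 (by linarith)
  obtain ⟨g, hg, hgup⟩ := exists_nat_exp_neg_le (c := 2 * (k * 2 ^ m * (1 / β))) hlam hlam1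
    (by linarith)
  obtain ⟨e, he, heup⟩ := exists_nat_exp_neg_le (c := 12 * (1 / β * (1 / δ))) hlam hlam1
    (by linarith)
  have hWup' := log_const_mul_le (c := 6) (x := 1 / δ) (by norm_num) (by positivity)
  have hgup' := log_const_mul_le (c := 2) (x := k * 2 ^ m * (1 / β)) (by norm_num) (by positivity)
  have heup' := log_const_mul_le (c := 12) (x := 1 / β * (1 / δ)) (by norm_num) (by positivity)
  have hlogm : m * Real.log 2 ≤ (m : ℝ) ^ 2 := by
    have h1 : (1 : ℝ) ≤ m := by exact_mod_cast hm1
    nlinarith [Real.log_two_lt_d9]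
  have hglog : Real.log (k * 2 ^ m * (1 / β)) =
      Real.log k + m * Real.log 2 + Real.log (1 / β) := by
    rw [Real.log_mul (by positivity) (by positivity), Real.log_mul (by positivity) (by positivity),
      Real.log_pow]
  have helog : Real.log (1 / β * (1 / δ)) = Real.log (1 / β) + Real.log (1 / δ) :=
    Real.log_mul (by positivity) (by positivity)
  have hE0 : 0 ≤ 8 * (m : ℝ) ^ 2 / lam := by positivity
  obtain ⟨b, hb, hbup⟩ : ∃ b : ℕ, 8 * (m : ℝ) ^ 2 / lam ≤ b ∧ lam * b ≤ 8 * (m : ℝ) ^ 2 + 1 := by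
    refine ⟨_, Nat.le_ceil _, ?_⟩
    calc lam * ⌈8 * (m : ℝ) ^ 2 / lam⌉₊ ≤ lam * (8 * (m : ℝ) ^ 2 / lam + 1) := by
          gcongr; exact (Nat.ceil_lt_add_one hE0).le
      _ = 8 * (m : ℝ) ^ 2 + lam := by field_simp
      _ ≤ 8 * (m : ℝ) ^ 2 + 1 := by linarith
  have hDle : (⌊α * n / 4⌋₊ : ℝ) ≤ α * n / 4 := Nat.floor_le (by positivity)
  have hDlt : α * n / 4 < ⌊α * n / 4⌋₊ + 1 := Nat.lt_floor_add_one _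
  have hαn0 : 0 ≤ α * n := by positivity
  have hαn1 : α * n * ε ≤ α * n := mul_le_of_le_one_right hαn0 hε1.le
  refine ⟨m, W, W + 1 + g, b + e, ⌊α * n / 4⌋₊, hm1, by omega, ?_, ?_, by linarith, ?_, ?_, ?_⟩
  · have hroom : lam * ((b + e) + (W + 1 + g) + 1) ≤ lam * ⌊α * n / 4⌋₊ := by
      have h3 : lam * (α * n / 4) = α * n * ε / 40 := by rw [hlamdef]; ring
      have h4 : lam * (α * n / 4) ≤ lam * (⌊α * n / 4⌋₊ + 1) := by gcongr
      have h5 : lam * ((b + e) + (W + 1 + g) + 1) =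
        lam * b + lam * e + lam * W + lam * g + 2 * lam := by ring
      linarith
    have := le_of_mul_le_mul_left hroom hlam
    exact_mod_cast this
  · have h1 : α * n / 8 ≤ ⌊α * n / 4⌋₊ := by linarith
    have h2 : (n : ℝ) ≤ 2 ^ m * (2 * ⌊α * n / 4⌋₊) := by
      have h3 : (4 / α) * (2 * (α * n / 8)) ≤ 2 ^ m * (2 * (⌊α * n / 4⌋₊ : ℝ)) := by gcongr
      have h4 : (4 / α) * (2 * (α * n / 8)) = n := by field_simp; ring
      linarith
    exact_mod_cast h2
  · refine hW.trans (le_of_eq ?_)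
    field_simp
  · have h1 : lam * (((W + 1 + g : ℕ) : ℝ) - W - 1) = lam * g := by push_cast; ring
    rw [h1]
    calc (k : ℝ) * (2 ^ m * Real.exp (-(lam * g))) ≤
          k * (2 ^ m * (1 / (2 * (k * 2 ^ m * (1 / β))))) := by gcongr
      _ = β / 2 := by field_simp
  · have h1 : Real.exp (-(lam * (((b + e : ℕ) : ℝ) - 8 * m ^ 2 / lam))) ≤
        Real.exp (-(lam * e)) := by
      refine Real.exp_le_exp.mpr (neg_le_neg (mul_le_mul_of_nonneg_left ?_ hlam.le))
      push_cast
      linarith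
    have h2 : 1 / (12 * (1 / β * (1 / δ))) = β * δ / 12 := by field_simp
    linarith

/-- At the base rate `lam / m` of the node variables, `8 * m ^ 2 / lam` exceeds the median of the
largest displacement: a factor `m` comes from the rate, the other from the number of nodes in a
partial sum and from the union over the targets. -/
theorem median_bound {m T : ℕ} (hm : 1 ≤ m) (hT : T < 2 ^ m) {lam : ℝ} (hlam : 0 < lam) :
    (T : ℝ) * (4 ^ m * Real.exp (-(lam / m / 2 * (8 * m ^ 2 / lam)))) ≤ 1 / 2 := by
  have hm' : (0 : ℝ) < m := by exact_mod_cast hm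
  have h1 : lam / m / 2 * (8 * m ^ 2 / lam) = m * 4 := by field_simp; norm_num
  have h2 : (T : ℝ) ≤ 2 ^ m := by exact_mod_cast hT.le
  have h3 : Real.exp (-4) ≤ 1 / 16 := by
    have h4 : (2 : ℝ) ≤ Real.exp 1 := by linarith [Real.add_one_le_exp 1]
    have h5 : (2 : ℝ) ^ 4 ≤ Real.exp 4 := by
      calc (2 : ℝ) ^ 4 ≤ Real.exp 1 ^ 4 := by gcongr
        _ = Real.exp 4 := by rw [← Real.exp_nat_mul]; norm_num
    rw [Real.exp_neg, one_div]
    exact inv_anti₀ (by norm_num) (by linarith)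
  rw [h1, ← mul_neg, Real.exp_nat_mul]
  calc (T : ℝ) * (4 ^ m * Real.exp (-4) ^ m) ≤ 2 ^ m * (4 ^ m * (1 / 16) ^ m) := by gcongr
    _ = (1 / 2) ^ m := by rw [← mul_pow, ← mul_pow]; norm_num
    _ ≤ (1 / 2) ^ 1 := pow_le_pow_of_le_one (by norm_num) (by norm_num) hm
    _ = 1 / 2 := by norm_num

/-! ### Large error bounds -/

/-- The mechanism without switches, which answers `1 / 2` to every query.  It settles the case
`1 / 2 ≤ α`, where `log (1 / α)` may be too small to pay for any noise. -/
noncomputable def halfFamily : SwitchFamily Unit 0 where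
  hazard _ _ := 0
  side _ _ := true
  decode _ := ⟨1 / 2, by norm_num, by norm_num⟩
  hazard_nonneg _ _ := le_rfl
  hazard_le_one _ _ := zero_le_one
  measurable_hazard _ := measurable_const
  measurable_side _ := measurable_const

theorem corollary5p8 :
    ∃ C : ℝ, 0 < C ∧
      ∀ (k n : ℕ) (α β ε δ : ℝ), 1 ≤ k →
        0 < α → α < 1 → 0 < β → β < 1 → 0 < ε → ε < 1 → 0 < δ → δ < 1 →
        C * ((Real.log k + Real.log (1 / α) ^ (5 / 2 : ℝ) + Real.log (1 / (β * ε * δ))) /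
          (α * ε)) ≤ n →
        ∃ M : InteractiveAlg (Fin n → unitInterval) unitInterval unitInterval,
          M.IsPrivate k ε δ ∧ M.IsAccurate thresholdQuery k α β := by
  refine ⟨100000, by norm_num, ?_⟩
  intro k n α β ε δ hk hα hα1 hβ hβ1 hε hε1 hδ hδ1 hn
  rcases lt_or_ge α (1 / 2) with hα2 | hα2
  · obtain ⟨m, W, K, E, D, hm, hWK, hD, hnD, hDα, hW, hK, hE⟩ :=
      exists_parameters hk hα hα2 hβ hβ1 hε hε1 hδ hδ1 hn
    have hlam : 0 < ε / 10 := by positivity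
    have hm' : (0 : ℝ) < m := by exact_mod_cast hm
    have hpow : 1 ≤ 2 ^ m := Nat.one_le_two_pow
    have hT : 2 ^ m - 1 < 2 ^ m := by omega
    have ha : 0 < ε / 10 / m := by positivity
    have := isMarkovKernel_noisyData n m (2 ^ m - 1) W _ ha hlam.le
    have htail := (tiltedNoise_maxNoise_gt (targetCover m (2 ^ m - 1)) _ ha hlam.le
      (fun t => card_dyadicCover_le m _) (by positivity) (median_bound hm hT hlam) E).trans
      (ENNReal.ofReal_le_ofReal hE)
    refine ⟨(thresholdFamily n m (2 ^ m - 1) W D K (ε / 10)).toAlg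
      (noisyData n m (2 ^ m - 1) W _ ha (ε / 10)), ?_, ?_⟩
    · have h := isPrivate_thresholdFamily (n := n) (k := k) (D := D) (K := K) (E := E)
        (d := δ / 6) hlam.le (by linarith) ha
        (div_mul_cancel₀ _ hm'.ne').le hT (by omega) hD (by positivity)
        (htail.trans (ENNReal.ofReal_le_ofReal (by nlinarith))) hW
      convert h using 1 <;> ring
    · have hn0 : 0 < n := by
        rcases Nat.eq_zero_or_pos n with h0 | h0
        · exfalso
          subst h0
          have : (0 : ℝ) < D := by exact_mod_cast (by omega : 0 < D)
          rw [Nat.cast_zero, mul_zero] at hDα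
          linarith
        · exact h0
      refine isAccurate_thresholdFamily hlam.le ha hn0 hWK hD ?_ hDα hβ.le
        (htail.trans (ENNReal.ofReal_le_ofReal (by nlinarith))) ?_
      · rwa [Nat.sub_add_cancel hpow]
      · refine le_trans ?_ hK
        have : ((2 ^ m - 1 : ℕ) : ℝ) ≤ 2 ^ m := by exact_mod_cast hT.le
        gcongr
  · set κ : Kernel (Fin n → unitInterval) Unit := Kernel.const _ (Measure.dirac ())
    refine ⟨halfFamily.toAlg κ, ?_, ?_⟩
    · intro A x x' _ S hS
      have heq : interaction (halfFamily.toAlg κ) A k x S =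
          interaction (halfFamily.toAlg κ) A k x' S := by
        rw [SwitchFamily.interaction_toAlg_apply _ _ _ _ _ hS,
          SwitchFamily.interaction_toAlg_apply _ _ _ _ _ hS]
        rfl
      have h1 : 1 ≤ Real.exp ε := Real.one_le_exp hε.le
      have h2 : 0 ≤ (interaction (halfFamily.toAlg κ) A k x').real S := measureReal_nonneg
      rw [measureReal_def, heq, ← measureReal_def]
      nlinarith
    · refine isAccurate_of_forall_le hβ.le _ fun A x => ?_
      have hG := measurableSet_accurate x α
      refine (SwitchFamily.interaction_toAlg_apply _ _ _ _ _
        (measurableSet_forall_mem hG).compl).trans_le ?_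
      refine (lintegral_mono (g := fun _ => 0) fun θ => ?_).trans (by simp)
      refine (lintegral_mono (g := fun _ => 0) fun w => ?_).trans (by simp)
      refine (halfFamily.transcriptFrom_not_mem_le κ A θ (fun _ _ => True) (ρ := 0) le_rfl
        (fun i => i.elim0) hG (fun q u _ => ?_) k _ w (fun i => i.elim0)).trans (by simp)
      have hv : statQueryValue (thresholdQuery q) x ∈ Set.Icc (0 : ℝ) 1 := by
        have h0 : (0 : ℝ) ≤ rankAt (fun i => (x i : ℝ)) q := by exact_mod_cast rankAt_nonneg _ q
        have h1 : (rankAt (fun i => (x i : ℝ)) q : ℝ) ≤ n := by exact_mod_cast rankAt_le _ q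
        rw [statQueryValue_thresholdQuery]
        exact ⟨by positivity, div_le_one_of_le₀ h1 (by positivity)⟩
      change |statQueryValue (thresholdQuery q) x - 1 / 2| ≤ α
      rw [abs_le]
      constructor <;> linarith [hv.1, hv.2]
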